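/- For integers $m\ge 3$ and $n\ge 1$ let the tadpole graph $T_{m,n}$ be the graph obtained from the disjoint union of the cycle $C_m$ on $x_1,\dots,x_m$ and the path $P_n$ on $y_1,\dots,y_n$ by adding the edge $\{x_m,y_1\}$. For a finite simple graph $G=(V,E)$ and a field $\Bbbk$, let $$A(G)=\Bbbk[x_v : v\in V]\,/\,\big((x_v^2 : v\in V)+(x_ux_v : \{u,v\}\in E)\big),$$ a standard graded algebra $A(G)=\bigoplus_{j\ge 0}[A(G)]_j$. A graded algebra $A$ has the weak Lefschetz property (WLP) if there is a linear form $\ell\in[A]_1$ such that for every $j\ge 0$ the multiplication map $\times\ell:[A]_j\to[A]_{j+1}$ is injective or surjective. Let $\Bbbk$ be a field of characteristic zero. Then: (i) for every integer $m\ge 3$, $A(T_{m,2})$ has the WLP if and only if $m\in\{4,5,7,8,11\}$; (ii) for every integer $m\ge 3$, $A(T_{m,3})$ has the WLP if and only if $m\in\{3,4,5,6,7,8,10,11,14\}$; (iii) for every integer $n\ge 1$, $A(T_{4,n})$ has the WLP if and only if $n\in\{1,2,3,4,5,6,7,9,10,13\}$; (iv) for every integer $n\ge 1$, $A(T_{5,n})$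 has the WLP if and only if $n\in\{1,2,3,5,6,9\}$. -/

import Mathlib

/-- The weak Lefschetz property of a graded `𝕜`-algebra `A = ⨁ⱼ 𝒜 j`: there is a linear form
`ℓ ∈ 𝒜 1` such that every multiplication map `×ℓ : 𝒜 j → 𝒜 (j + 1)` is injective or surjective.
(If `𝒜 j = 0` for all `j > s`, the condition holds automatically for `j ≥ s`, so only
`j = 0, …, s - 1` matter.) -/
def HasWLP {𝕜 A : Type*} [Field 𝕜] [CommRing A] [Algebra 𝕜 A] (𝒜 : ℕ → Submodule 𝕜 A) : Prop :=
  ∃ ℓ ∈ 𝒜 1, ∀ j : ℕ,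
    Set.InjOn (fun a : A => ℓ * a) (𝒜 j) ∨
      Set.SurjOn (fun a : A => ℓ * a) (𝒜 j) (𝒜 (j + 1))

/-- The grading of `R / I`, for `R` the standard graded polynomial ring: `[R / I]_j` is the image
of the forms of degree `j`. -/
noncomputable def quotientGrading {σ 𝕜 : Type*} [Field 𝕜] (I : Ideal (MvPolynomial σ 𝕜)) (j : ℕ) :
    Submodule 𝕜 (MvPolynomial σ 𝕜 ⧸ I) :=
  (MvPolynomial.homogeneousSubmodule σ 𝕜 j).map (Ideal.Quotient.mkₐ 𝕜 I).toLinearMap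

namespace SimpleGraph

/-- The edge ideal of a graph, generated by the `x_u x_v` with `{u, v}` an edge. -/
noncomputable def edgeIdeal {V : Type*} (𝕜 : Type*) [Field 𝕜] (G : SimpleGraph V) :
    Ideal (MvPolynomial V 𝕜) :=
  Ideal.span {f | ∃ u v : V, G.Adj u v ∧ f = MvPolynomial.X u * MvPolynomial.X v}

/-- The ideal generated by the squares of the variables and the edge ideal. -/
noncomputable def artinianIdeal {V : Type*} (𝕜 : Type*) [Field 𝕜] (G : SimpleGraph V) :
    Ideal (MvPolynomial V 𝕜) :=
  Ideal.span (Set.range fun v : V => (MvPolynomial.X v : MvPolynomial V 𝕜) ^ 2) ⊔ G.edgeIdeal 𝕜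

/-- The artinian monomial algebra `A(G)` associated to a graph. -/
abbrev artinianAlgebra {V : Type*} (𝕜 : Type*) [Field 𝕜] (G : SimpleGraph V) : Type _ :=
  MvPolynomial V 𝕜 ⧸ G.artinianIdeal 𝕜

/-- The graded pieces `[A(G)]_j`. -/
noncomputable def artinianGrading {V : Type*} (𝕜 : Type*) [Field 𝕜] (G : SimpleGraph V) :
    ℕ → Submodule 𝕜 (G.artinianAlgebra 𝕜) :=
  quotientGrading (G.artinianIdeal 𝕜)

/-- The tadpole graph `T_{m,n}` (for `m ≥ 3`, `n ≥ 1`): the disjoint union of the cycle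
`x_1, …, x_m` and the path `y_1, …, y_n`, together with the bridge `{x_m, y_1}`. With indices
counted from `0`, `x_m` is `Sum.inl (m - 1)` and `y_1` is `Sum.inr 0`. -/
def tadpole (m n : ℕ) : SimpleGraph (Fin m ⊕ Fin n) :=
  (cycleGraph m ⊕g pathGraph n) ⊔
    SimpleGraph.fromEdgeSet
      {e | ∃ (i : Fin m) (j : Fin n), (i : ℕ) + 1 = m ∧ (j : ℕ) = 0 ∧ e = s(Sum.inl i, Sum.inr j)}

end SimpleGraph

/-! ### Matrices over fields: one-sided inverses, reduction modulo a prime, generic injectivity. -/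

section MatrixFacts

open Polynomial

/-! The squarefree monomials of the independent sets form a basis of A(G). Since the ideal is
monomial, a generic linear form can be rescaled to ℓ, the sum of the variables, so the WLP only has
to be tested on ℓ (`hasWLP_iff`). This turns it into a statement about functions on independent
sets: `UpInjective` is injectivity of ×ℓ, and `DownInjective` is surjectivity, phrased as
injectivity of the transpose. All tadpoles with cycle length m are initial segments of one infinite
graph `lasso m`. Put N = m + n.

Failure. On four consecutive vertices, x₀ + x₁ - x₂ - x₃ is killed by the sum of its variables.
Products over disjoint blocks are killed by ℓ, so injectivity fails in degree ⌈N/4⌉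
(`not_upInjective_lasso`). Dually, products of the functionals dual to x_p - x_{p+1}, over pairs
separated by one skipped vertex, vanish on the image of ℓ, so surjectivity fails into every degree
up to ⌊N/3⌋ (`not_downInjective_lasso`). Both occur in one degree as soon as ⌈N/4⌉ + 1 ≤ ⌊N/3⌋, that
is, unless N ≤ 11 or N is 13, 14 or 17. This settles all failures in (ii) and (iii). In (i) a
multiple of 3 as cycle length admits pairs starting at vertex 0, and the triangle has its own linear
form; in (iv) a quadratic form on the pentagon with four tail vertices improves the degree
(`isUpKernel_pentagonKernel`).

Success. Finitely many graphs remain. Injectivity propagates downwards where independent sets can be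
enlarged, surjectivity upwards, so two consecutive degrees suffice. Both are certified by Gaussian
elimination modulo 7, which implies the result in characteristic zero. Large systems are first
broken up by deleting a vertex or its closed neighborhood (`UpInjective.split`,
`DownInjective.split`). -/

theorem Matrix.mulVec_injective_iff_exists_left_inverse {m n K : Type*} [Fintype m] [Fintype n]
    [DecidableEq m] [DecidableEq n] [Field K] {A : Matrix m n K} :
    Function.Injective A.mulVec ↔ ∃ L : Matrix n m K, L * A = 1 := by
  constructor
  · intro h
    obtain ⟨g, hg⟩ := LinearMap.exists_leftInverse_of_injective (Matrix.toLin' A)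
      (LinearMap.ker_eq_bot.2 h)
    refine ⟨LinearMap.toMatrix' g, ?_⟩
    have := congrArg LinearMap.toMatrix' hg
    rwa [LinearMap.toMatrix'_comp, LinearMap.toMatrix'_toLin', LinearMap.toMatrix'_id] at this
  · rintro ⟨L, hL⟩ x y hxy
    have := congrArg L.mulVec hxy
    simpa [Matrix.mulVec_mulVec, hL] using this

theorem Matrix.mulVec_surjective_iff_transpose_injective {m n K : Type*} [Fintype m] [Fintype n]
    [DecidableEq m] [DecidableEq n] [Field K] {A : Matrix m n K} :
    Function.Surjective A.mulVec ↔ Function.Injective A.transpose.mulVec := by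
  rw [Matrix.mulVec_surjective_iff_exists_right_inverse,
    Matrix.mulVec_injective_iff_exists_left_inverse]
  constructor
  · rintro ⟨B, hB⟩
    exact ⟨B.transpose, by rw [← Matrix.transpose_mul, hB, Matrix.transpose_one]⟩
  · rintro ⟨B, hB⟩
    refine ⟨B.transpose, ?_⟩
    rw [← Matrix.transpose_inj, Matrix.transpose_mul, Matrix.transpose_transpose, hB,
      Matrix.transpose_one]

theorem Matrix.mulVec_injective_of_det_mul_ne_zero {m n K : Type*} [Fintype m] [Fintype n]
    [DecidableEq n] [Field K] {A : Matrix m n K} (L : Matrix n m K)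
    (h : (L * A).det ≠ 0) : Function.Injective A.mulVec := by
  have hu : Function.Injective (L * A).mulVec :=
    Matrix.mulVec_injective_iff_isUnit.2 ((Matrix.isUnit_iff_isUnit_det _).2 h.isUnit)
  intro x y hxy
  apply hu
  simp only [← Matrix.mulVec_mulVec, hxy]

/-- An integer matrix that is injective modulo `p` is injective in characteristic zero. -/
theorem Matrix.mulVec_injective_of_zmod {m n K : Type*} [Fintype m] [Fintype n]
    [DecidableEq m] [DecidableEq n] [Field K] [CharZero K] (p : ℕ) [Fact p.Prime]
    {A : Matrix m n ℤ} (h : Function.Injective (A.map (Int.castRingHom (ZMod p))).mulVec) :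
    Function.Injective (A.map (Int.castRingHom K)).mulVec := by
  obtain ⟨L, hL⟩ := Matrix.mulVec_injective_iff_exists_left_inverse.1 h
  -- Lift the left inverse entrywise to the integers. The determinant of the product is then 1
  -- modulo `p`, hence a nonzero integer.
  choose L' hL' using fun i j => ZMod.intCast_surjective (L i j)
  have hmap : L = (Matrix.of L').map (Int.castRingHom (ZMod p)) := by
    ext i j
    simp [hL']
  have hdet : (Matrix.of L' * A).det ≠ 0 := by
    intro h0
    have h1 : Int.castRingHom (ZMod p) (Matrix.of L' * A).det = 1 := by
      rw [RingHom.map_det, RingHom.mapMatrix_apply, Matrix.map_mul, ← hmap, hL, Matrix.det_one]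
    rw [h0, map_zero] at h1
    exact zero_ne_one h1
  apply Matrix.mulVec_injective_of_det_mul_ne_zero ((Matrix.of L').map (Int.castRingHom K))
  rw [← Matrix.map_mul, ← RingHom.mapMatrix_apply, ← RingHom.map_det]
  simpa using hdet

/-- Injectivity is a generic property in a polynomial family of matrices. -/
theorem Matrix.exists_mulVec_injective_eval {m n K : Type*} [Fintype m] [Fintype n]
    [DecidableEq m] [DecidableEq n] [Field K] [Infinite K] (A : Matrix m n K[X])
    (h : Function.Injective (A.map (evalRingHom 0)).mulVec) {r : K[X]} (hr : r ≠ 0) :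
    ∃ t, r.eval t ≠ 0 ∧ Function.Injective (A.map (evalRingHom t)).mulVec := by
  obtain ⟨L, hL⟩ := Matrix.mulVec_injective_iff_exists_left_inverse.1 h
  have heval (t : K) : (L.map C * A).det.eval t = (L * A.map (evalRingHom t)).det := by
    rw [← coe_evalRingHom, RingHom.map_det, RingHom.mapMatrix_apply, Matrix.map_mul]
    congr 2
    ext i j
    simp
  have hq : (L.map C * A).det ≠ 0 := by
    intro h0
    have := heval 0
    rw [hL, h0] at this
    simp at this
  -- A single `t` must avoid the zeros of both polynomials; a nonzero product over an infinite field
  -- allows this.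
  obtain ⟨t, ht⟩ : ∃ t, (r * (L.map C * A).det).eval t ≠ 0 := by
    by_contra! hall
    exact mul_ne_zero hr hq (Polynomial.funext fun t => by simpa using hall t)
  rw [eval_mul, heval] at ht
  exact ⟨t, left_ne_zero_of_mul ht,
    Matrix.mulVec_injective_of_det_mul_ne_zero L (right_ne_zero_of_mul ht)⟩

/-- Serves as the polynomial `r` above: at its nonzeros `t`, all shifted coefficients `a v + t` are
invertible. -/
theorem Polynomial.prod_C_add_X_ne_zero {V K : Type*} [Fintype V] [Field K] (a : V → K) :
    ∏ v, (C (a v) + X) ≠ 0 :=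
  Finset.prod_ne_zero_iff.2 fun v _ => by
    rw [add_comm]
    exact X_add_C_ne_zero (a v)

end MatrixFacts

namespace SimpleGraph

/-! ### Multiplication by a linear form as an incidence matrix of independent sets. -/

section Incidence

variable {V : Type*} [DecidableEq V] (G : SimpleGraph V)

/-- A function on the independent `j`-subsets of `W` whose sum over the facets of every
independent `(j + 1)`-subset vanishes is zero. -/
def UpInjective (K : Type*) [Field K] (W : Finset V) (j : ℕ) : Prop :=
  ∀ f : Finset V → K,
    (∀ T ⊆ W, G.IsIndepSet (T : Set V) → T.card = j + 1 → ∑ v ∈ T, f (T.erase v) = 0) →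
    ∀ S ⊆ W, G.IsIndepSet (S : Set V) → S.card = j → f S = 0

/-- A function on the independent `(j + 1)`-subsets of `W` whose sum over the extensions of every
independent `j`-subset vanishes is zero. -/
def DownInjective (K : Type*) [Field K] (W : Finset V) (j : ℕ) : Prop :=
  ∀ f : Finset V → K, (∀ T : Finset V, ¬ G.IsIndepSet (T : Set V) → f T = 0) →
    (∀ S ⊆ W, G.IsIndepSet (S : Set V) → S.card = j → ∑ v ∈ W \ S, f (insert v S) = 0) →
    ∀ T ⊆ W, G.IsIndepSet (T : Set V) → T.card = j + 1 → f T = 0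

/-- The independent sets with `j` elements. -/
abbrev IndepSetsOfCard (j : ℕ) : Type _ :=
  {S : Finset V // G.IsIndepSet (S : Set V) ∧ S.card = j}

/-- The matrix of multiplication by `∑ a_v x_v` from degree `j` to degree `j + 1`. -/
def incidence {R : Type*} [CommRing R] (a : V → R) (j : ℕ) :
    Matrix (G.IndepSetsOfCard (j + 1)) (G.IndepSetsOfCard j) R :=
  Matrix.of fun T S => ∑ v ∈ T.1, if T.1.erase v = S.1 then a v else 0

variable {G}

theorem IsIndepSet.erase {T : Finset V} (h : G.IsIndepSet (T : Set V)) (v : V) :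
    G.IsIndepSet (T.erase v : Set V) :=
  Set.Pairwise.mono (by simp) h

theorem incidence_map {R R' : Type*} [CommRing R] [CommRing R'] (φ : R →+* R') (a : V → R)
    (j : ℕ) : (G.incidence a j).map φ = G.incidence (fun v => φ (a v)) j := by
  ext T S
  simp [incidence, map_sum, apply_ite φ]

/-- Extension by zero of a function on the independent `j`-sets. -/
theorem exists_eq_restrict {R : Type*} [Zero R] {j : ℕ} (g : G.IndepSetsOfCard j → R) :
    ∃ f : Finset V → R, (∀ T : Finset V, ¬ G.IsIndepSet (T : Set V) → f T = 0) ∧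
      g = fun S => f S.1 := by
  classical
  refine ⟨fun S => if h : G.IsIndepSet (S : Set V) ∧ S.card = j then g ⟨S, h⟩ else 0,
    fun T hT => dif_neg fun h => hT h.1, ?_⟩
  funext S
  simp only [dif_pos S.2]

theorem incidence_one_eq_map {R : Type*} [CommRing R] (j : ℕ) :
    G.incidence (fun _ => (1 : R)) j =
      (G.incidence (fun _ => (1 : ℤ)) j).map (Int.castRingHom R) := by
  rw [incidence_map]
  simp

theorem incidence_eval {K : Type*} [Field K] {j : ℕ} (a : V → K) (t : K) :
    (G.incidence (fun v => Polynomial.C (a v) + Polynomial.X) j).map (Polynomial.evalRingHom t) =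
      G.incidence (fun v => a v + t) j := by
  rw [incidence_map]
  simp

variable [Fintype V]

noncomputable instance (j : ℕ) : Fintype (G.IndepSetsOfCard j) := by
  classical exact inferInstance

theorem incidence_mulVec {R : Type*} [CommRing R] (a : V → R) (j : ℕ) (f : Finset V → R)
    (T : G.IndepSetsOfCard (j + 1)) :
    (G.incidence a j).mulVec (fun S => f S.1) T = ∑ v ∈ T.1, a v * f (T.1.erase v) := by
  simp only [Matrix.mulVec, dotProduct, incidence, Matrix.of_apply, Finset.sum_mul]
  rw [Finset.sum_comm]
  refine Finset.sum_congr rfl fun v hv => ?_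
  rw [Finset.sum_eq_single ⟨T.1.erase v, T.2.1.erase v, by
    rw [Finset.card_erase_of_mem hv, T.2.2]; rfl⟩]
  · simp
  · intro S _ hS
    rw [if_neg, zero_mul]
    intro h
    exact hS (Subtype.ext h.symm)
  · simp

theorem incidence_transpose_mulVec {R : Type*} [CommRing R] (a : V → R) (j : ℕ)
    (f : Finset V → R) (hf : ∀ T : Finset V, ¬ G.IsIndepSet (T : Set V) → f T = 0)
    (S : G.IndepSetsOfCard j) :
    (G.incidence a j).transpose.mulVec (fun T => f T.1) S =
      ∑ v ∈ Finset.univ \ S.1, a v * f (insert v S.1) := by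
  simp only [Matrix.mulVec, dotProduct, incidence, Matrix.of_apply, Matrix.transpose_apply]
  have h1 (T : G.IndepSetsOfCard (j + 1)) :
      (∑ v ∈ T.1, if T.1.erase v = S.1 then a v else 0) * f T.1 =
        ∑ v ∈ Finset.univ \ S.1, if T.1 = insert v S.1 then a v * f T.1 else 0 := by
    simp only [Finset.sum_mul, ite_mul, zero_mul]
    rw [← Finset.sum_filter, ← Finset.sum_filter]
    refine Finset.sum_congr ?_ fun _ _ => rfl
    ext v
    simp only [Finset.mem_filter, Finset.mem_sdiff, Finset.mem_univ, true_and]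
    constructor
    · rintro ⟨hv, h⟩
      rw [← h]
      exact ⟨Finset.notMem_erase v _, (Finset.insert_erase hv).symm⟩
    · rintro ⟨hv, h⟩
      rw [h]
      exact ⟨Finset.mem_insert_self v _, Finset.erase_insert hv⟩
  simp only [h1]
  rw [Finset.sum_comm]
  refine Finset.sum_congr rfl fun v hv => ?_
  by_cases hi : G.IsIndepSet ((insert v S.1 : Finset V) : Set V)
  · rw [Finset.sum_eq_single ⟨insert v S.1, hi, by
      rw [Finset.card_insert_of_notMem (by simpa using hv), S.2.2]⟩]
    · simp
    · intro T _ hT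
      rw [if_neg]
      intro h
      exact hT (Subtype.ext h)
    · simp
  · rw [hf _ hi, mul_zero]
    refine Finset.sum_eq_zero fun T _ => ?_
    rw [if_neg]
    intro h
    exact hi (h ▸ T.2.1)

theorem incidence_injective_iff {K : Type*} [Field K] (a : V → K) (j : ℕ) :
    Function.Injective (G.incidence a j).mulVec ↔
      ∀ f : Finset V → K, (∀ T : Finset V, G.IsIndepSet (T : Set V) → T.card = j + 1 →
        ∑ v ∈ T, a v * f (T.erase v) = 0) →
        ∀ S : Finset V, G.IsIndepSet (S : Set V) → S.card = j → f S = 0 := by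
  rw [← Matrix.coe_mulVecLin, ← LinearMap.ker_eq_bot, LinearMap.ker_eq_bot']
  simp only [Matrix.mulVecLin_apply]
  constructor
  · intro h f hf S hS hc
    refine congrFun (h (fun S => f S.1) ?_) ⟨S, hS, hc⟩
    funext T
    rw [incidence_mulVec, hf _ T.2.1 T.2.2, Pi.zero_apply]
  · intro h g hg
    obtain ⟨f, -, rfl⟩ := exists_eq_restrict g
    funext S
    refine h f (fun T hT hc => ?_) S.1 S.2.1 S.2.2
    simpa [incidence_mulVec] using congrFun hg ⟨T, hT, hc⟩

theorem incidence_transpose_injective_iff {K : Type*} [Field K] (a : V → K) (j : ℕ) :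
    Function.Injective (G.incidence a j).transpose.mulVec ↔
      ∀ f : Finset V → K, (∀ T : Finset V, ¬ G.IsIndepSet (T : Set V) → f T = 0) →
        (∀ S : Finset V, G.IsIndepSet (S : Set V) → S.card = j →
          ∑ v ∈ Finset.univ \ S, a v * f (insert v S) = 0) →
        ∀ T : Finset V, G.IsIndepSet (T : Set V) → T.card = j + 1 → f T = 0 := by
  rw [← Matrix.coe_mulVecLin, ← LinearMap.ker_eq_bot, LinearMap.ker_eq_bot']
  simp only [Matrix.mulVecLin_apply]
  constructor
  · intro h f hf0 hf T hT hc
    refine congrFun (h (fun S => f S.1) ?_) ⟨T, hT, hc⟩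
    funext S
    rw [incidence_transpose_mulVec _ _ _ hf0, hf _ S.2.1 S.2.2, Pi.zero_apply]
  · intro h g hg
    obtain ⟨f, hf0, rfl⟩ := exists_eq_restrict g
    funext T
    refine h f hf0 (fun S hS hc => ?_) T.1 T.2.1 T.2.2
    simpa [incidence_transpose_mulVec _ _ _ hf0] using congrFun hg ⟨S, hS, hc⟩

theorem upInjective_univ_iff {K : Type*} [Field K] {j : ℕ} :
    G.UpInjective K Finset.univ j ↔
      Function.Injective (G.incidence (fun _ => (1 : K)) j).mulVec := by
  simp [incidence_injective_iff, UpInjective]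

theorem downInjective_univ_iff {K : Type*} [Field K] {j : ℕ} :
    G.DownInjective K Finset.univ j ↔
      Function.Injective (G.incidence (fun _ => (1 : K)) j).transpose.mulVec := by
  simp [incidence_transpose_injective_iff, DownInjective]

theorem UpInjective.of_zmod {K : Type*} [Field K] [CharZero K] {p : ℕ} [Fact p.Prime] {j : ℕ}
    (h : G.UpInjective (ZMod p) Finset.univ j) : G.UpInjective K Finset.univ j := by
  classical
  rw [upInjective_univ_iff, incidence_one_eq_map] at h ⊢
  exact Matrix.mulVec_injective_of_zmod p h

theorem DownInjective.of_zmod {K : Type*} [Field K] [CharZero K] {p : ℕ} [Fact p.Prime] {j : ℕ}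
    (h : G.DownInjective (ZMod p) Finset.univ j) : G.DownInjective K Finset.univ j := by
  classical
  rw [downInjective_univ_iff, incidence_one_eq_map, ← Matrix.transpose_map] at h ⊢
  exact Matrix.mulVec_injective_of_zmod p h

/-! ### From an arbitrary linear form to the sum of the variables. -/

section Scaling

open Polynomial

variable {K : Type*} [Field K] {j : ℕ}

/-- If some linear form acts injectively, then so does the sum of the variables. -/
theorem upInjective_of_incidence_injective [Infinite K] {a : V → K}
    (h : Function.Injective (G.incidence a j).mulVec) : G.UpInjective K Finset.univ j := by
  classical
  obtain ⟨t, ht, hinj⟩ := Matrix.exists_mulVec_injective_eval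
    (G.incidence (fun v => C (a v) + X) j) (by simpa only [incidence_eval, add_zero] using h)
    (prod_C_add_X_ne_zero a)
  rw [incidence_eval, incidence_injective_iff] at hinj
  simp only [eval_prod, eval_add, eval_C, eval_X, Finset.prod_ne_zero_iff, Finset.mem_univ,
    true_implies] at ht
  intro f hf S _ hS hc
  -- Rescaling the variables carries the kernel of the sum of the variables into the kernel of the
  -- form with coefficients `a v + t`.
  have := hinj (fun S => (∏ v ∈ S, (a v + t)) * f S) (fun T hT hc => ?_) S hS hc
  · exact (mul_eq_zero.1 this).resolve_left (Finset.prod_ne_zero_iff.2 fun v _ => ht v)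
  · rw [← mul_zero (∏ v ∈ T, (a v + t)), ← hf T (Finset.subset_univ T) hT hc, Finset.mul_sum]
    refine Finset.sum_congr rfl fun v hv => ?_
    rw [← Finset.mul_prod_erase T _ hv, mul_assoc]

/-- If some linear form acts surjectively, then so does the sum of the variables. -/
theorem downInjective_of_incidence_surjective [Infinite K] {a : V → K}
    (h : Function.Surjective (G.incidence a j).mulVec) : G.DownInjective K Finset.univ j := by
  classical
  rw [Matrix.mulVec_surjective_iff_transpose_injective] at h
  obtain ⟨t, ht, hinj⟩ := Matrix.exists_mulVec_injective_eval
    (G.incidence (fun v => C (a v) + X) j).transpose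
    (by simpa only [Matrix.transpose_map, incidence_eval, add_zero] using h)
    (prod_C_add_X_ne_zero a)
  rw [Matrix.transpose_map, incidence_eval, incidence_transpose_injective_iff] at hinj
  simp only [eval_prod, eval_add, eval_C, eval_X, Finset.prod_ne_zero_iff, Finset.mem_univ,
    true_implies] at ht
  intro f hf0 hf T _ hT hc
  -- Functionals transform contragrediently, hence the inverse factor.
  have := hinj (fun T => (∏ v ∈ T, (a v + t))⁻¹ * f T) (fun T hT => by simp [hf0 T hT])
    (fun S hS hc => ?_) T hT hc
  · exact (mul_eq_zero.1 this).resolve_left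
      (inv_ne_zero (Finset.prod_ne_zero_iff.2 fun v _ => ht v))
  · rw [← mul_zero (∏ v ∈ S, (a v + t))⁻¹, ← hf S (Finset.subset_univ S) hS hc, Finset.mul_sum]
    refine Finset.sum_congr rfl fun v hv => ?_
    rw [Finset.prod_insert (by simpa using hv), mul_inv, ← mul_assoc, ← mul_assoc,
      mul_inv_cancel₀ (ht v), one_mul]

end Scaling

end Incidence

/-! ### The monomial basis of A(G) and reduction of the WLP to independent sets. -/

section Algebra

open MvPolynomial

variable {V : Type*}

theorem artinianIdeal_eq_span_monomial (G : SimpleGraph V) (𝕜 : Type*) [Field 𝕜] :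
    G.artinianIdeal 𝕜 = Ideal.span ((fun d => monomial d (1 : 𝕜)) ''
      (Set.range (fun v => Finsupp.single v 2) ∪
        {d | ∃ u v, G.Adj u v ∧ d = Finsupp.single u 1 + Finsupp.single v 1})) := by
  rw [artinianIdeal, edgeIdeal, ← Ideal.span_union, Set.image_union]
  congr 2
  · rw [← Set.range_comp]
    congr 1
    funext v
    simp [X_pow_eq_monomial]
  · ext f
    simp only [Set.mem_ofPred_eq, Set.mem_image]
    constructor
    · rintro ⟨u, v, h, rfl⟩
      exact ⟨_, ⟨u, v, h, rfl⟩, by simp [X, monomial_mul]⟩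
    · rintro ⟨_, ⟨u, v, h, rfl⟩, rfl⟩
      exact ⟨u, v, h, by simp [X, monomial_mul]⟩

theorem isHomogeneous_linear [Fintype V] {𝕜 : Type*} [Field 𝕜] (a : V → 𝕜) :
    (∑ v, a v • X v : MvPolynomial V 𝕜).IsHomogeneous 1 :=
  (homogeneousSubmodule V 𝕜 1).sum_mem fun v _ =>
    Submodule.smul_mem _ _ (isHomogeneous_X 𝕜 v)

theorem mem_artinianGrading_iff (G : SimpleGraph V) {𝕜 : Type*} [Field 𝕜] {j : ℕ}
    {x : G.artinianAlgebra 𝕜} :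
    x ∈ G.artinianGrading 𝕜 j ↔
      ∃ P : MvPolynomial V 𝕜, P.IsHomogeneous j ∧ Ideal.Quotient.mk (G.artinianIdeal 𝕜) P = x :=
  Iff.rfl

theorem mem_artinianGrading_one_iff [Fintype V] (G : SimpleGraph V) {𝕜 : Type*} [Field 𝕜]
    {x : G.artinianAlgebra 𝕜} :
    x ∈ G.artinianGrading 𝕜 1 ↔
      ∃ a : V → 𝕜, Ideal.Quotient.mk (G.artinianIdeal 𝕜) (∑ v, a v • X v) = x := by
  rw [mem_artinianGrading_iff]
  constructor
  · rintro ⟨P, hP, rfl⟩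
    rw [← mem_homogeneousSubmodule, homogeneousSubmodule_one_eq_span_X,
      Submodule.mem_span_range_iff_exists_fun] at hP
    obtain ⟨a, rfl⟩ := hP
    exact ⟨a, rfl⟩
  · rintro ⟨a, rfl⟩
    exact ⟨_, isHomogeneous_linear a, rfl⟩

variable [DecidableEq V]

/-- The exponent vector of the squarefree monomial `∏ v ∈ S, x_v`. -/
noncomputable def squarefreeExponent (S : Finset V) : V →₀ ℕ :=
  Finsupp.indicator S fun _ _ => 1

theorem squarefreeExponent_apply (S : Finset V) (v : V) :
    squarefreeExponent S v = if v ∈ S then 1 else 0 := by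
  simp [squarefreeExponent, Finsupp.indicator_apply]

theorem support_squarefreeExponent (S : Finset V) : (squarefreeExponent S).support = S := by
  ext v
  simp [squarefreeExponent_apply]

theorem squarefreeExponent_injective :
    Function.Injective (squarefreeExponent : Finset V → V →₀ ℕ) := fun S T h => by
  rw [← support_squarefreeExponent S, h, support_squarefreeExponent]

theorem degree_squarefreeExponent (S : Finset V) : (squarefreeExponent S).degree = S.card := by
  rw [Finsupp.degree_apply, support_squarefreeExponent, Finset.card_eq_sum_ones]
  exact Finset.sum_congr rfl fun v hv => by simp [squarefreeExponent_apply, hv]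

theorem squarefreeExponent_sub_single (S : Finset V) (v : V) :
    squarefreeExponent S - Finsupp.single v 1 = squarefreeExponent (S.erase v) := by
  ext u
  by_cases h : v = u
  · subst h
    by_cases hv : v ∈ S <;> simp [squarefreeExponent_apply, hv]
  · by_cases hu : u ∈ S <;> simp [squarefreeExponent_apply, hu, Ne.symm h]

variable (G : SimpleGraph V) {𝕜 : Type*} [Field 𝕜]

/-- A monomial lies outside the ideal exactly when no square of a variable and no edge divides it,
that is, when it is squarefree with independent support. These monomials therefore give a basis of
the quotient. -/
theorem mem_artinianIdeal_iff {P : MvPolynomial V 𝕜} :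
    P ∈ G.artinianIdeal 𝕜 ↔
      ∀ S : Finset V, G.IsIndepSet (S : Set V) → P.coeff (squarefreeExponent S) = 0 := by
  rw [artinianIdeal_eq_span_monomial, mem_ideal_span_monomial_image]
  constructor
  · intro h S hS
    by_contra hne
    obtain ⟨d, hd | ⟨u, v, huv, rfl⟩, hle⟩ := h _ (mem_support_iff.2 hne)
    · obtain ⟨v, rfl⟩ := hd
      have := hle v
      rw [squarefreeExponent_apply, Finsupp.single_eq_same] at this
      split_ifs at this <;> omega
    · have hu := hle u
      have hv := hle v
      simp only [squarefreeExponent_apply, Finsupp.add_apply, Finsupp.single_eq_same] at hu hv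
      have hu' : u ∈ S := by
        by_contra hn
        rw [if_neg hn] at hu
        omega
      have hv' : v ∈ S := by
        by_contra hn
        rw [if_neg hn] at hv
        omega
      exact hS hu' hv' huv.ne huv
  · intro h d hd
    by_contra! hcon
    have hle (v : V) : d v ≤ 1 := by
      have := hcon _ (Or.inl ⟨v, rfl⟩)
      rw [Finsupp.single_le_iff] at this
      omega
    have hd' : d = squarefreeExponent d.support := by
      ext v
      have := hle v
      rw [squarefreeExponent_apply]
      split_ifs with hv
      · have := Finsupp.mem_support_iff.1 hv
        omega
      · simpa using hv
    refine mem_support_iff.1 hd ?_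
    rw [hd']
    refine h _ fun u hu v hv hne huv => hcon _ (Or.inr ⟨u, v, huv, rfl⟩) fun w => ?_
    have hu := Finsupp.mem_support_iff.1 hu
    have hv := Finsupp.mem_support_iff.1 hv
    rw [Finsupp.add_apply, Finsupp.single_apply, Finsupp.single_apply]
    split_ifs with h1 h2 h2
    · exact absurd (h1.trans h2.symm) hne
    · subst h1
      omega
    · subst h2
      omega
    · omega

theorem coeff_linear_mul [Fintype V] (a : V → 𝕜) (P : MvPolynomial V 𝕜) (T : Finset V) :
    ((∑ v, a v • X v) * P).coeff (squarefreeExponent T) =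
      ∑ v ∈ T, a v * P.coeff (squarefreeExponent (T.erase v)) := by
  rw [Finset.sum_mul, coeff_sum, ← Finset.sum_subset (Finset.subset_univ T)]
  · refine Finset.sum_congr rfl fun v hv => ?_
    rw [smul_mul_assoc, coeff_smul, coeff_X_mul', support_squarefreeExponent, if_pos hv,
      squarefreeExponent_sub_single, smul_eq_mul]
  · intro v _ hv
    rw [smul_mul_assoc, coeff_smul, coeff_X_mul', support_squarefreeExponent, if_neg hv, smul_zero]

theorem coeff_squarefreeExponent_of_isHomogeneous {P : MvPolynomial V 𝕜} {j : ℕ}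
    (hP : P.IsHomogeneous j) {S : Finset V} (hS : S.card ≠ j) :
    P.coeff (squarefreeExponent S) = 0 :=
  hP.coeff_eq_zero (by rwa [degree_squarefreeExponent])

theorem mk_eq_mk_iff {P Q : MvPolynomial V 𝕜} {j : ℕ} (hP : P.IsHomogeneous j)
    (hQ : Q.IsHomogeneous j) :
    Ideal.Quotient.mk (G.artinianIdeal 𝕜) P = Ideal.Quotient.mk (G.artinianIdeal 𝕜) Q ↔
      ∀ S : Finset V, G.IsIndepSet (S : Set V) → S.card = j →
        P.coeff (squarefreeExponent S) = Q.coeff (squarefreeExponent S) := by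
  rw [Ideal.Quotient.eq, mem_artinianIdeal_iff]
  simp only [coeff_sub, sub_eq_zero]
  refine ⟨fun h S hS _ => h S hS, fun h S hS => ?_⟩
  by_cases hc : S.card = j
  · exact h S hS hc
  · rw [coeff_squarefreeExponent_of_isHomogeneous hP hc,
      coeff_squarefreeExponent_of_isHomogeneous hQ hc]

variable [Fintype V]

/-- A form of degree `j` with prescribed coefficients at the squarefree monomials. -/
theorem exists_isHomogeneous_coeff (j : ℕ) (f : Finset V → 𝕜) :
    ∃ P : MvPolynomial V 𝕜, P.IsHomogeneous j ∧
      ∀ S : Finset V, S.card = j → P.coeff (squarefreeExponent S) = f S := by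
  refine ⟨∑ S : Finset V with S.card = j, monomial (squarefreeExponent S) (f S), ?_, ?_⟩
  · refine (homogeneousSubmodule V 𝕜 j).sum_mem fun S hS => ?_
    exact isHomogeneous_monomial _
      ((degree_squarefreeExponent S).trans (Finset.mem_filter.1 hS).2)
  · intro S hS
    rw [coeff_sum, Finset.sum_eq_single S]
    · simp
    · intro T _ hT
      rw [coeff_monomial, if_neg fun h => hT (squarefreeExponent_injective h)]
    · intro h
      simp [hS] at h

theorem injOn_mul_iff (a : V → 𝕜) (j : ℕ) :
    Set.InjOn (fun x => Ideal.Quotient.mk (G.artinianIdeal 𝕜) (∑ v, a v • X v) * x)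
      (G.artinianGrading 𝕜 j) ↔ Function.Injective (G.incidence a j).mulVec := by
  rw [incidence_injective_iff]
  constructor
  · intro h f hf S hS hc
    obtain ⟨P, hP, hPf⟩ := exists_isHomogeneous_coeff j f
    have h0 := @h (Ideal.Quotient.mk _ P) ⟨P, hP, rfl⟩ 0 (zero_mem _) ?_
    · rw [← map_zero (Ideal.Quotient.mk _), G.mk_eq_mk_iff hP (isHomogeneous_zero V 𝕜 j)] at h0
      rw [← hPf S hc, h0 S hS hc, coeff_zero]
    · simp only [mul_zero]
      rw [← map_mul, ← map_zero (Ideal.Quotient.mk _),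
        G.mk_eq_mk_iff ((isHomogeneous_linear a).mul hP) (isHomogeneous_zero V 𝕜 (1 + j))]
      intro T hT hc
      rw [coeff_linear_mul, coeff_zero, ← hf T hT (by omega)]
      refine Finset.sum_congr rfl fun v hv => ?_
      rw [hPf _ (by rw [Finset.card_erase_of_mem hv]; omega)]
  · rintro h _ ⟨P, hP, rfl⟩ _ ⟨Q, hQ, rfl⟩ hPQ
    refine (G.mk_eq_mk_iff hP hQ).2 fun S hS hc => sub_eq_zero.1 ?_
    refine h (fun S => P.coeff (squarefreeExponent S) - Q.coeff (squarefreeExponent S))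
      (fun T hT hc => ?_) S hS hc
    have h1 := (G.mk_eq_mk_iff ((isHomogeneous_linear a).mul hP)
      ((isHomogeneous_linear a).mul hQ)).1 (by simpa using hPQ) T hT (by omega)
    rw [coeff_linear_mul, coeff_linear_mul, ← sub_eq_zero, ← Finset.sum_sub_distrib] at h1
    simpa only [mul_sub] using h1

theorem surjOn_mul_iff (a : V → 𝕜) (j : ℕ) :
    Set.SurjOn (fun x => Ideal.Quotient.mk (G.artinianIdeal 𝕜) (∑ v, a v • X v) * x)
      (G.artinianGrading 𝕜 j) (G.artinianGrading 𝕜 (j + 1)) ↔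
      Function.Surjective (G.incidence a j).mulVec := by
  constructor
  · intro h g
    obtain ⟨f, -, rfl⟩ := exists_eq_restrict g
    obtain ⟨Q, hQ, hQf⟩ := exists_isHomogeneous_coeff (j + 1) f
    obtain ⟨_, ⟨P, hP, rfl⟩, hPQ⟩ := h ⟨Q, hQ, rfl⟩
    refine ⟨fun S => P.coeff (squarefreeExponent S.1), ?_⟩
    funext T
    have hLP : ((∑ v, a v • X v) * P).IsHomogeneous (j + 1) := by
      rw [add_comm]
      exact (isHomogeneous_linear a).mul hP
    have h1 := (G.mk_eq_mk_iff hLP hQ).1 (by simpa using hPQ) T.1 T.2.1 T.2.2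
    rw [incidence_mulVec a j (fun S => P.coeff (squarefreeExponent S)), ← hQf T.1 T.2.2, ← h1,
      coeff_linear_mul]
  · rintro h _ ⟨Q, hQ, rfl⟩
    obtain ⟨g, hg⟩ := h fun T => Q.coeff (squarefreeExponent T.1)
    obtain ⟨f, -, rfl⟩ := exists_eq_restrict g
    obtain ⟨P, hP, hPf⟩ := exists_isHomogeneous_coeff j f
    refine ⟨Ideal.Quotient.mk _ P, ⟨P, hP, rfl⟩, ?_⟩
    have hLP : ((∑ v, a v • X v) * P).IsHomogeneous (j + 1) := by
      rw [add_comm]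
      exact (isHomogeneous_linear a).mul hP
    refine (map_mul _ _ _).symm.trans ((G.mk_eq_mk_iff hLP hQ).2 fun T hT hc => ?_)
    have h1 := congrFun hg ⟨T, hT, hc⟩
    rw [incidence_mulVec] at h1
    dsimp only at h1
    rw [← h1, coeff_linear_mul]
    refine Finset.sum_congr rfl fun v hv => ?_
    rw [hPf _ (by rw [Finset.card_erase_of_mem hv]; omega)]

/-- The weak Lefschetz property of `A(G)` can be tested on the sum of the variables. -/
theorem hasWLP_iff [CharZero 𝕜] :
    HasWLP (G.artinianGrading 𝕜) ↔
      ∀ j, G.UpInjective 𝕜 Finset.univ j ∨ G.DownInjective 𝕜 Finset.univ j := by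
  classical
  constructor
  · rintro ⟨ℓ, hℓ, h⟩ j
    obtain ⟨a, rfl⟩ := G.mem_artinianGrading_one_iff.1 hℓ
    exact (h j).imp (fun h => upInjective_of_incidence_injective ((G.injOn_mul_iff a j).1 h))
      (fun h => downInjective_of_incidence_surjective ((G.surjOn_mul_iff a j).1 h))
  · intro h
    refine ⟨_, G.mem_artinianGrading_one_iff.2 ⟨fun _ => 1, rfl⟩, fun j => (h j).imp
      (fun h => (G.injOn_mul_iff _ j).2 (upInjective_univ_iff.1 h))
      (fun h => (G.surjOn_mul_iff _ j).2 ?_)⟩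
    rw [Matrix.mulVec_surjective_iff_transpose_injective]
    exact downInjective_univ_iff.1 h

end Algebra

/-! ### Transport along induced embeddings of graphs. -/

section Embedding

variable {V U : Type*} {G : SimpleGraph V} {H : SimpleGraph U}

theorem isIndepSet_map_iff (ι : G ↪g H) {S : Finset V} :
    H.IsIndepSet (S.map ι.toEmbedding : Set U) ↔ G.IsIndepSet (S : Set V) := by
  rw [Finset.coe_map, IsIndepSet, Set.InjOn.pairwise_image ι.toEmbedding.injective.injOn]
  exact ⟨fun h a ha b hb hab hadj => h ha hb hab (ι.map_adj_iff.2 hadj),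
    fun h a ha b hb hab hadj => h ha hb hab (ι.map_adj_iff.1 hadj)⟩

variable [DecidableEq V] [DecidableEq U] {K : Type*} [Field K] {W : Finset V} {j : ℕ}

theorem upInjective_map_iff (ι : G ↪g H) :
    H.UpInjective K (W.map ι.toEmbedding) j ↔ G.UpInjective K W j := by
  constructor
  · intro h f hf S hSW hS hc
    have := h (fun S => f (S.preimage ι.toEmbedding ι.toEmbedding.injective.injOn)) ?_
      (S.map ι.toEmbedding)
      (Finset.map_subset_map.2 hSW) ((isIndepSet_map_iff ι).2 hS) (by simpa using hc)
    · simpa only [Finset.preimage_map] using this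
    · intro T hTW hT hc
      obtain ⟨T, hT', rfl⟩ := Finset.subset_map_iff.1 hTW
      rw [Finset.sum_map, ← hf T hT' ((isIndepSet_map_iff ι).1 hT) (by simpa using hc)]
      refine Finset.sum_congr rfl fun v _ => ?_
      rw [← Finset.map_erase, Finset.preimage_map]
  · intro h f hf S hSW hS hc
    obtain ⟨S, hS', rfl⟩ := Finset.subset_map_iff.1 hSW
    refine h (fun S => f (S.map ι.toEmbedding)) (fun T hTW hT hc => ?_) S hS'
      ((isIndepSet_map_iff ι).1 hS) (by simpa using hc)
    rw [← hf (T.map ι.toEmbedding) (Finset.map_subset_map.2 hTW) ((isIndepSet_map_iff ι).2 hT)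
      (by simpa using hc), Finset.sum_map]
    simp only [Finset.map_erase]

theorem downInjective_map_iff (ι : G ↪g H) :
    H.DownInjective K (W.map ι.toEmbedding) j ↔ G.DownInjective K W j := by
  classical
  constructor
  · intro h f hf0 hf S hSW hS hc
    have hval (T : Finset V) : (if H.IsIndepSet (T.map ι.toEmbedding : Set U) then
        f ((T.map ι.toEmbedding).preimage ι.toEmbedding ι.toEmbedding.injective.injOn) else 0) =
          f T := by
      rw [Finset.preimage_map]
      split_ifs with h
      · rfl
      · exact (hf0 T fun h' => h ((isIndepSet_map_iff ι).2 h')).symm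
    have := h (fun S => if H.IsIndepSet (S : Set U) then
        f (S.preimage ι.toEmbedding ι.toEmbedding.injective.injOn) else 0)
      (fun T hT => if_neg hT) ?_
      (S.map ι.toEmbedding)
      (Finset.map_subset_map.2 hSW) ((isIndepSet_map_iff ι).2 hS) (by simpa using hc)
    · rwa [hval] at this
    · intro T hTW hT hc
      obtain ⟨T, hT', rfl⟩ := Finset.subset_map_iff.1 hTW
      rw [← Finset.map_sdiff, Finset.sum_map]
      simp only [← Finset.map_insert, hval]
      exact hf T hT' ((isIndepSet_map_iff ι).1 hT) (by simpa using hc)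
  · intro h f hf0 hf S hSW hS hc
    obtain ⟨S, hS', rfl⟩ := Finset.subset_map_iff.1 hSW
    refine h (fun S => f (S.map ι.toEmbedding))
      (fun T hT => hf0 _ fun h => hT ((isIndepSet_map_iff ι).1 h)) (fun T hTW hT hc => ?_) S hS'
      ((isIndepSet_map_iff ι).1 hS) (by simpa using hc)
    rw [← hf (T.map ι.toEmbedding) (Finset.map_subset_map.2 hTW) ((isIndepSet_map_iff ι).2 hT)
      (by simpa using hc), ← Finset.map_sdiff, Finset.sum_map]
    simp only [Finset.map_insert]

end Embedding

/-! ### Tadpoles as initial segments of one infinite graph. -/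

section Lasso

/-- The infinite tadpole graph: the ray `0, 1, 2, …` together with the edge `{0, m - 1}`. -/
def lasso (m : ℕ) : SimpleGraph ℕ :=
  SimpleGraph.fromRel fun a b => a + 1 = b ∨ (a = 0 ∧ b + 1 = m)

theorem lasso_adj {m a b : ℕ} : (lasso m).Adj a b ↔
    a ≠ b ∧ ((a + 1 = b ∨ (a = 0 ∧ b + 1 = m)) ∨ (b + 1 = a ∨ (b = 0 ∧ a + 1 = m))) :=
  SimpleGraph.fromRel_adj _ _ _

theorem tadpole_adj_inl_inl {m n : ℕ} {i j : Fin m} :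
    (tadpole m n).Adj (.inl i) (.inl j) ↔ (cycleGraph m).Adj i j := by
  simp [tadpole]

theorem tadpole_adj_inr_inr {m n : ℕ} {i j : Fin n} :
    (tadpole m n).Adj (.inr i) (.inr j) ↔ (pathGraph n).Adj i j := by
  simp [tadpole]

theorem tadpole_adj_inl_inr {m n : ℕ} {i : Fin m} {j : Fin n} :
    (tadpole m n).Adj (.inl i) (.inr j) ↔ (i : ℕ) + 1 = m ∧ (j : ℕ) = 0 := by
  simp [tadpole]

/-- The tadpole graph is an initial segment of the infinite tadpole graph. -/
def tadpoleEmbedding {m : ℕ} (hm : 3 ≤ m) (n : ℕ) : tadpole m n ↪g lasso m where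
  toFun := Sum.elim (fun i => i) (fun j => m + j)
  inj' := by
    rintro (i | i) (j | j) h <;> simp only [Sum.elim_inl, Sum.elim_inr] at h
    · rw [Fin.ext h]
    · omega
    · omega
    · rw [Fin.ext (Nat.add_left_cancel h)]
  map_rel_iff' := by
    have hcross (i : Fin m) (j : Fin n) :
        (lasso m).Adj i (m + j) ↔ (tadpole m n).Adj (.inl i) (.inr j) := by
      rw [lasso_adj, tadpole_adj_inl_inr]
      omega
    rintro (i | i) (j | j)
    · change (lasso m).Adj i j ↔ _
      have hi := i.2
      have hj := j.2
      -- The order of `i` and `j` decides which of the two differences in `Fin m` wraps around.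
      rcases lt_trichotomy i j with h | h | h
      · rw [tadpole_adj_inl_inl, cycleGraph_adj', lasso_adj, Fin.coe_sub_iff_lt.2 h,
          Fin.coe_sub_iff_le.2 h.le]
        have h' : (i : ℕ) < j := h
        omega
      · rw [h]
        exact iff_of_false (SimpleGraph.irrefl _) (SimpleGraph.irrefl _)
      · rw [tadpole_adj_inl_inl, cycleGraph_adj', lasso_adj, Fin.coe_sub_iff_lt.2 h,
          Fin.coe_sub_iff_le.2 h.le]
        have h' : (j : ℕ) < i := h
        omega
    · exact hcross i j
    · rw [adj_comm, (tadpole m n).adj_comm]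
      exact hcross j i
    · change (lasso m).Adj (m + i) (m + j) ↔ _
      rw [tadpole_adj_inr_inr, pathGraph_adj, lasso_adj]
      omega

theorem map_tadpoleEmbedding_univ {m : ℕ} (hm : 3 ≤ m) (n : ℕ) :
    Finset.univ.map (tadpoleEmbedding hm n).toEmbedding = Finset.range (m + n) := by
  ext k
  simp only [Finset.mem_map, Finset.mem_univ, true_and, Finset.mem_range]
  constructor
  · rintro ⟨i | i, rfl⟩
    · exact i.2.trans_le (Nat.le_add_right m n)
    · exact Nat.add_lt_add_left i.2 m
  · intro hk
    rcases lt_or_ge k m with h | h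
    · exact ⟨.inl ⟨k, h⟩, rfl⟩
    · exact ⟨.inr ⟨k - m, by omega⟩, Nat.add_sub_cancel' h⟩

theorem hasWLP_tadpole_iff {m : ℕ} (hm : 3 ≤ m) (n : ℕ) {𝕜 : Type*} [Field 𝕜] [CharZero 𝕜] :
    HasWLP ((tadpole m n).artinianGrading 𝕜) ↔
      ∀ j, (lasso m).UpInjective 𝕜 (Finset.range (m + n)) j ∨
        (lasso m).DownInjective 𝕜 (Finset.range (m + n)) j := by
  simp only [hasWLP_iff, ← map_tadpoleEmbedding_univ hm n, upInjective_map_iff,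
    downInjective_map_iff]

/-- The weak Lefschetz property of `A(T_{m,n})` in characteristic zero follows from its analogue
for the sum of the variables modulo `p`. -/
theorem hasWLP_tadpole_of_zmod {m : ℕ} (hm : 3 ≤ m) (n : ℕ) {𝕜 : Type*} [Field 𝕜] [CharZero 𝕜]
    (p : ℕ) [Fact p.Prime]
    (h : ∀ j, (lasso m).UpInjective (ZMod p) (Finset.range (m + n)) j ∨
      (lasso m).DownInjective (ZMod p) (Finset.range (m + n)) j) :
    HasWLP ((tadpole m n).artinianGrading 𝕜) := by
  rw [hasWLP_iff]
  simp only [← map_tadpoleEmbedding_univ hm n, upInjective_map_iff, downInjective_map_iff] at h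
  exact fun j => (h j).imp UpInjective.of_zmod DownInjective.of_zmod

end Lasso

/-! ### Injectivity passes to lower degrees, surjectivity to higher ones. -/

section Propagation

variable {V : Type*} [DecidableEq V] {G : SimpleGraph V} {K : Type*} [Field K] {W : Finset V}
  {j : ℕ}

/-- Surjectivity of multiplication by the sum of the variables propagates upwards. -/
theorem DownInjective.succ (h : G.DownInjective K W j) : G.DownInjective K W (j + 1) := by
  intro f hf0 hf T hTW hT hc
  obtain ⟨v, hv⟩ : T.Nonempty := by
    rw [← Finset.card_pos]
    omega
  -- Contract the functional with `x_v`: the result vanishes on the image one degree lower, and its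
  -- value at `T.erase v` is `f T`.
  have := h (fun S => if v ∈ S then 0 else f (insert v S)) (fun S hS => ?_) (fun S hSW hS hSc => ?_)
    (T.erase v) ((Finset.erase_subset _ _).trans hTW) (hT.erase v)
    (by rw [Finset.card_erase_of_mem hv]; omega)
  · simpa [Finset.insert_erase hv] using this
  · split_ifs with hvS
    · rfl
    · exact hf0 _ fun hi => hS (hi.mono (by simp))
  · by_cases hvS : v ∈ S
    · exact Finset.sum_eq_zero fun u _ => if_pos (Finset.mem_insert_of_mem hvS)
    · have hsub : W \ insert v S ⊆ W \ S := Finset.sdiff_subset_sdiff le_rfl (by simp)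
      rw [← Finset.sum_subset hsub]
      · by_cases hi : G.IsIndepSet (insert v S : Finset V)
        · rw [← hf (insert v S) (Finset.insert_subset (hTW hv) hSW) hi
            (by rw [Finset.card_insert_of_notMem hvS, hSc])]
          refine Finset.sum_congr rfl fun u hu => ?_
          simp only [Finset.mem_sdiff, Finset.mem_insert, not_or] at hu
          rw [if_neg (by simp [Ne.symm hu.2.1, hvS]), Finset.insert_comm]
        · refine Finset.sum_eq_zero fun u _ => ?_
          split_ifs with hvu
          · rfl
          · refine hf0 _ fun hi' => hi (hi'.mono ?_)
            rw [Finset.insert_comm]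
            simp
      · intro u hu hu'
        have : u = v := by
          by_contra hne
          simp_all
        simp [this]

theorem DownInjective.mono (h : G.DownInjective K W j) {i : ℕ} (hij : j ≤ i) :
    G.DownInjective K W i :=
  Nat.le_induction h (fun _ _ h => h.succ) i hij

/-- Injectivity of multiplication by the sum of the variables propagates downwards, as long as
every independent set can be enlarged. -/
theorem UpInjective.of_succ (h : G.UpInjective K W (j + 1))
    (hext : ∀ S ⊆ W, G.IsIndepSet (S : Set V) → S.card = j →
      ∃ v ∈ W, v ∉ S ∧ G.IsIndepSet (insert v S : Finset V)) : G.UpInjective K W j := by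
  intro f hf S hSW hS hc
  obtain ⟨v, hvW, hvS, hi⟩ := hext S hSW hS hc
  -- This is `x_v f`. It is killed along with `f`, and its coefficient at `insert v S` is `f S`.
  have := h (fun S => if v ∈ S then f (S.erase v) else 0) (fun T hTW hT hTc => ?_) (insert v S)
    (Finset.insert_subset hvW hSW) hi (by rw [Finset.card_insert_of_notMem hvS, hc])
  · simpa [Finset.erase_insert hvS] using this
  · by_cases hvT : v ∈ T
    · rw [← Finset.add_sum_erase T _ hvT]
      simp only [Finset.mem_erase, ne_eq, not_true_eq_false, false_and, if_false, zero_add]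
      rw [← hf (T.erase v) ((Finset.erase_subset _ _).trans hTW) (hT.erase v)
        (by rw [Finset.card_erase_of_mem hvT]; omega)]
      refine Finset.sum_congr rfl fun u hu => ?_
      rw [if_pos ⟨fun h => by simp [h] at hu, hvT⟩, Finset.erase_right_comm]
    · exact Finset.sum_eq_zero fun u _ => if_neg fun h => hvT (Finset.mem_of_mem_erase h)

end Propagation

/-! ### Products of kernel elements on disjoint vertex sets. -/

section Kernels

variable {V : Type*} [DecidableEq V] (G : SimpleGraph V) {K : Type*} [Field K]

/-- `f` is annihilated by multiplication by the sum of the variables of `B`. -/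
def IsUpKernel (B : Finset V) (f : Finset V → K) : Prop :=
  ∀ T ⊆ B, G.IsIndepSet (T : Set V) → ∑ v ∈ T, f (T.erase v) = 0

/-- `f` is a functional supported on independent subsets of `B` which vanishes on the image of
multiplication by the sum of the variables. -/
def IsDownKernel (B : Finset V) (f : Finset V → K) : Prop :=
  (∀ T, f T ≠ 0 → G.IsIndepSet (T : Set V) ∧ T ⊆ B) ∧ ∀ S, ∑ v ∈ B \ S, f (insert v S) = 0

variable {G} {B C : Finset V} {g h : Finset V → K}

theorem IsUpKernel.not_upInjective (hg : G.IsUpKernel B g) {S : Finset V} (hSB : S ⊆ B)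
    (hS : G.IsIndepSet (S : Set V)) (hne : g S ≠ 0) : ¬ G.UpInjective K B S.card :=
  fun hinj => hne (hinj g (fun T hT hi _ => hg T hT hi) S hSB hS rfl)

/-- The sum of the variables of `B ∪ C` is a sum of two forms, each of which kills its own factor.
Edges between `B` and `C` do no harm, because relations are only required at independent sets. -/
theorem IsUpKernel.mul (hg : G.IsUpKernel B g) (hh : G.IsUpKernel C h) (hBC : Disjoint B C) :
    G.IsUpKernel (B ∪ C) fun S => g (S ∩ B) * h (S ∩ C) := by
  intro T hT hi
  have hTd : Disjoint (T ∩ B) (T ∩ C) := hBC.mono Finset.inter_subset_right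
    Finset.inter_subset_right
  have hTu : T = (T ∩ B) ∪ (T ∩ C) := by
    rw [← Finset.inter_union_distrib_left, Finset.inter_eq_left.2 hT]
  have h1 : ∑ v ∈ T ∩ B, g (T.erase v ∩ B) * h (T.erase v ∩ C) = 0 := by
    rw [← zero_mul (h (T ∩ C)), ← hg (T ∩ B) Finset.inter_subset_right (hi.mono (by simp)),
      Finset.sum_mul]
    refine Finset.sum_congr rfl fun v hv => ?_
    have hvC : v ∉ T ∩ C := Finset.disjoint_left.1 hTd hv
    rw [Finset.erase_inter, Finset.erase_inter, Finset.erase_eq_of_notMem hvC]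
  have h2 : ∑ v ∈ T ∩ C, g (T.erase v ∩ B) * h (T.erase v ∩ C) = 0 := by
    rw [← mul_zero (g (T ∩ B)), ← hh (T ∩ C) Finset.inter_subset_right (hi.mono (by simp)),
      Finset.mul_sum]
    refine Finset.sum_congr rfl fun v hv => ?_
    have hvB : v ∉ T ∩ B := Finset.disjoint_right.1 hTd hv
    rw [Finset.erase_inter, Finset.erase_inter, Finset.erase_eq_of_notMem hvB]
  conv_lhs => rw [hTu, Finset.sum_union hTd]
  rw [← hTu, h1, h2, add_zero]

/-- A linear form whose coefficients at nonadjacent vertices are opposite is annihilated. -/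
theorem isUpKernel_linear {c : V → K}
    (hc : ∀ u ∈ B, ∀ v ∈ B, u ≠ v → ¬ G.Adj u v → c u + c v = 0) :
    G.IsUpKernel B fun S => if S.card = 1 then ∑ v ∈ S, c v else 0 := by
  intro T hT hi
  by_cases h2 : T.card = 2
  · obtain ⟨u, v, huv, rfl⟩ := Finset.card_eq_two.1 h2
    rw [Finset.sum_pair huv, Finset.erase_insert (by simpa using huv), Finset.pair_comm,
      Finset.erase_insert (by simpa using huv.symm)]
    have := hc u (hT (by simp)) v (hT (by simp)) huv (hi (by simp) (by simp) huv)
    simpa [add_comm] using this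
  · refine Finset.sum_eq_zero fun v hv => if_neg ?_
    rw [Finset.card_erase_of_mem hv]
    omega

/-- A functional supported inside `B` stays annihilating on any larger `W`: vertices outside `B`
contribute zero. -/
theorem IsDownKernel.not_downInjective (hg : G.IsDownKernel B g) {W : Finset V} (hBW : B ⊆ W)
    {T : Finset V} {j : ℕ} (hc : T.card = j + 1) (hne : g T ≠ 0) : ¬ G.DownInjective K W j := by
  intro hinj
  obtain ⟨hi, hTB⟩ := hg.1 T hne
  refine hne (hinj g (fun S hS => ?_) (fun S _ _ _ => ?_) T (hTB.trans hBW) hi hc)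
  · by_contra h0
    exact hS (hg.1 S h0).1
  · rw [← hg.2 S]
    refine (Finset.sum_subset (Finset.sdiff_subset_sdiff hBW le_rfl) fun v hv hv' => ?_).symm
    by_contra h0
    have := (hg.1 _ h0).2 (Finset.mem_insert_self v S)
    simp_all

/-- Dual to the product of kernel elements, but now edges between `B` and `C` must be excluded: a
union of two support sets has to be independent. -/
theorem IsDownKernel.mul (hg : G.IsDownKernel B g) (hh : G.IsDownKernel C h) (hBC : Disjoint B C)
    (hadj : ∀ u ∈ B, ∀ v ∈ C, ¬ G.Adj u v) :
    G.IsDownKernel (B ∪ C) fun S => if S ⊆ B ∪ C then g (S ∩ B) * h (S ∩ C) else 0 := by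
  constructor
  · intro T hT
    have hTBC : T ⊆ B ∪ C := by
      by_contra hn
      exact hT (if_neg hn)
    simp only [if_pos hTBC] at hT
    refine ⟨fun u hu v hv huv => ?_, hTBC⟩
    have hgi := (hg.1 _ (left_ne_zero_of_mul hT)).1
    have hhi := (hh.1 _ (right_ne_zero_of_mul hT)).1
    rcases Finset.mem_union.1 (hTBC hu) with huB | huC <;>
      rcases Finset.mem_union.1 (hTBC hv) with hvB | hvC
    · exact hgi (by simpa using ⟨hu, huB⟩) (by simpa using ⟨hv, hvB⟩) huv
    · exact hadj u huB v hvC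
    · exact fun h => hadj v hvB u huC h.symm
    · exact hhi (by simpa using ⟨hu, huC⟩) (by simpa using ⟨hv, hvC⟩) huv
  · intro S
    by_cases hS : S ⊆ B ∪ C
    · rw [Finset.union_sdiff_distrib, Finset.sum_union
        (hBC.mono Finset.sdiff_subset Finset.sdiff_subset)]
      have h1 : ∑ v ∈ B \ S, (if insert v S ⊆ B ∪ C then
          g (insert v S ∩ B) * h (insert v S ∩ C) else 0) = 0 := by
        rw [← zero_mul (h (S ∩ C)), ← hg.2 (S ∩ B), Finset.sum_mul]
        refine Finset.sum_congr (by ext; simp) fun v hv => ?_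
        have hvB := (Finset.mem_sdiff.1 hv).1
        rw [if_pos (Finset.insert_subset (Finset.mem_union_left _ hvB) hS),
          Finset.insert_inter_of_mem hvB,
          Finset.insert_inter_of_notMem (Finset.disjoint_left.1 hBC hvB)]
      have h2 : ∑ v ∈ C \ S, (if insert v S ⊆ B ∪ C then
          g (insert v S ∩ B) * h (insert v S ∩ C) else 0) = 0 := by
        rw [← mul_zero (g (S ∩ B)), ← hh.2 (S ∩ C), Finset.mul_sum]
        refine Finset.sum_congr (by ext; simp) fun v hv => ?_
        have hvC := (Finset.mem_sdiff.1 hv).1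
        rw [if_pos (Finset.insert_subset (Finset.mem_union_right _ hvC) hS),
          Finset.insert_inter_of_mem hvC,
          Finset.insert_inter_of_notMem (Finset.disjoint_right.1 hBC hvC)]
      rw [h1, h2, add_zero]
    · refine Finset.sum_eq_zero fun v _ => if_neg fun h => hS ?_
      exact (Finset.subset_insert v S).trans h

/-- The functional takes the values 1 and -1 on the two variables, so it kills their sum. It lives
in degree one, so the only nontrivial condition is at the empty set. -/
theorem isDownKernel_pair {p q : V} (hpq : p ≠ q) :
    G.IsDownKernel {p, q} fun S => if S = {p} then (1 : K) else if S = {q} then -1 else 0 := by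
  constructor
  · intro T hT
    by_cases h1 : T = {p}
    · subst h1
      simp [IsIndepSet]
    · by_cases h2 : T = {q}
      · subst h2
        simp [IsIndepSet]
      · simp [h1, h2] at hT
  · intro S
    rcases S.eq_empty_or_nonempty with rfl | hS
    · rw [Finset.sdiff_empty, Finset.sum_pair hpq]
      simp [hpq.symm]
    · refine Finset.sum_eq_zero fun v hv => ?_
      have hcard : 1 < (insert v S).card := by
        rw [Finset.card_insert_of_notMem (Finset.mem_sdiff.1 hv).2]
        have := hS.card_pos
        omega
      dsimp only
      rw [if_neg, if_neg] <;>
      · intro h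
        rw [h] at hcard
        simp at hcard

end Kernels

/-! ### Explicit kernel elements and annihilating functionals on the infinite tadpole. -/

section LassoKernels

variable (K : Type*) [Field K]

/-- On the first `N` vertices there is an element annihilated by the sum of the variables, which
involves an independent set with `a` elements that leaves room for enlargement at the end. -/
def LassoUpKernel (m N a : ℕ) : Prop :=
  ∃ (f : Finset ℕ → K) (S : Finset ℕ), (lasso m).IsUpKernel (Finset.range N) f ∧
    (∀ s ∈ S, s + 1 < N) ∧ (lasso m).IsIndepSet (S : Set ℕ) ∧ S.card = a ∧ f S ≠ 0 ∧
    (0 ∉ S ∨ m ≤ N)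

variable {K}

theorem lassoUpKernel_zero (m : ℕ) : LassoUpKernel K m 0 0 :=
  ⟨fun _ => 1, ∅, fun T hT _ => by simp [Finset.subset_empty.1 hT], by simp, by simp [IsIndepSet],
    rfl, one_ne_zero, by simp⟩

/-- The form is x_N + x_{N+1} - x_{N+2} - x_{N+3}, truncated if `r < 4`. Distinct vertices with
equal sign are consecutive, hence adjacent; the edge `{0, m - 1}` can only remove conditions. -/
theorem isUpKernel_four_vertices (m N r : ℕ) (hr : r ≤ 4) :
    (lasso m).IsUpKernel (Finset.Ico N (N + r)) fun S =>
      if S.card = 1 then ∑ v ∈ S, (if v < N + 2 then (1 : K) else -1) else 0 := by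
  refine isUpKernel_linear fun u hu v hv huv hadj => ?_
  simp only [lasso_adj, Finset.mem_Ico] at hu hv hadj
  by_cases h1 : u < N + 2 <;> by_cases h2 : v < N + 2
  · omega
  · simp [h1, h2]
  · simp [h1, h2]
  · omega

/-- Multiply by the linear form of the next block. The room left at the end and the clause `0 ∉ S ∨
m ≤ N` ensure that `w` is adjacent to nothing in `S`, so the product has a nonzero coefficient
there. -/
theorem LassoUpKernel.extend {m N a : ℕ} (h : LassoUpKernel K m N a) {r w : ℕ} (hr : r ≤ 4)
    (hw : w ∈ Finset.Ico N (N + r)) :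
    ∃ (f : Finset ℕ → K) (S : Finset ℕ), (lasso m).IsUpKernel (Finset.range (N + r)) f ∧
      (∀ s ∈ S, s + 1 < N) ∧ (lasso m).IsIndepSet (insert w S : Finset ℕ) ∧
      (insert w S).card = a + 1 ∧ f (insert w S) ≠ 0 ∧ (0 ∉ S ∨ m ≤ N) := by
  obtain ⟨f, S, hf, hSN, hS, hc, hne, h0⟩ := h
  have hw' := Finset.mem_Ico.1 hw
  have hwS : w ∉ S := fun h => by
    have := hSN w h
    omega
  have hdisj : Disjoint (Finset.range N) (Finset.Ico N (N + r)) := by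
    rw [Finset.disjoint_left]
    intro v hv hv'
    simp only [Finset.mem_range, Finset.mem_Ico] at hv hv'
    omega
  have hunion : Finset.range N ∪ Finset.Ico N (N + r) = Finset.range (N + r) := by
    ext v
    simp only [Finset.mem_union, Finset.mem_range, Finset.mem_Ico]
    omega
  refine ⟨_, S, hunion ▸ hf.mul (isUpKernel_four_vertices m N r hr) hdisj, hSN, ?_,
    by rw [Finset.card_insert_of_notMem hwS, hc], ?_, h0⟩
  · have : Std.Symm fun u v => ¬ (lasso m).Adj u v := ⟨fun u v h h' => h h'.symm⟩
    rw [Finset.coe_insert, IsIndepSet, Set.pairwise_insert_of_symm]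
    refine ⟨hS, fun s hs _ hadj => ?_⟩
    have := hSN s hs
    rw [lasso_adj] at hadj
    have : s = 0 → m ≤ N := fun h => h0.resolve_left (by rw [← h]; simpa using hs)
    omega
  · have h1 : insert w S ∩ Finset.range N = S := by
      ext v
      simp only [Finset.mem_inter, Finset.mem_insert, Finset.mem_range]
      constructor
      · rintro ⟨rfl | hv, hv'⟩
        · omega
        · exact hv
      · intro hv
        exact ⟨Or.inr hv, by have := hSN v hv; omega⟩
    have h2 : insert w S ∩ Finset.Ico N (N + r) = {w} := by
      ext v
      simp only [Finset.mem_inter, Finset.mem_insert, Finset.mem_Ico, Finset.mem_singleton]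
      constructor
      · rintro ⟨rfl | hv, hv'⟩
        · rfl
        · have := hSN v hv
          omega
      · rintro rfl
        exact ⟨Or.inl rfl, hw'⟩
    simp only [h1, h2]
    refine mul_ne_zero hne ?_
    rw [Finset.card_singleton, if_pos rfl, Finset.sum_singleton]
    split_ifs <;> simp

theorem LassoUpKernel.add_four {m N a : ℕ} (h : LassoUpKernel K m N a) :
    LassoUpKernel K m (N + 4) (a + 1) := by
  -- Choosing `N + 1` instead of `N` keeps 0 out of the set even when `N = 0`, and still leaves room
  -- before `N + 4`.
  obtain ⟨f, S, hf, hSN, hS, hc, hne, h0⟩ := h.extend (r := 4) (w := N + 1) le_rfl (by simp)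
  refine ⟨f, _, hf, fun s hs => ?_, hS, hc, hne, h0.imp (fun h0 => ?_) (fun h => by omega)⟩
  · rcases Finset.mem_insert.1 hs with rfl | hs
    · omega
    · have := hSN s hs
      omega
  · simpa using h0

theorem LassoUpKernel.not_upInjective {m N a r : ℕ} (h : LassoUpKernel K m N a) (hr0 : 0 < r)
    (hr : r ≤ 4) : ¬ (lasso m).UpInjective K (Finset.range (N + r)) (a + 1) := by
  obtain ⟨f, S, hf, hSN, hS, hc, hne, -⟩ := h.extend (w := N) hr (by simp [hr0])
  rw [← hc]
  refine hf.not_upInjective (fun s hs => Finset.mem_range.2 ?_) hS hne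
  rcases Finset.mem_insert.1 hs with rfl | hs
  · omega
  · have := hSN s hs
    omega

theorem lassoUpKernel_four_mul (m k : ℕ) : LassoUpKernel K m (4 * k) k := by
  induction k with
  | zero => exact lassoUpKernel_zero m
  | succ k ih => exact ih.add_four

/-- Cut the vertices into full blocks of four and a last block of one to four vertices; one linear
factor per block gives degree ⌈N/4⌉. -/
theorem not_upInjective_lasso (m : ℕ) {N : ℕ} (hN : 0 < N) :
    ¬ (lasso m).UpInjective K (Finset.range N) ((N + 3) / 4) := by
  have := (lassoUpKernel_four_mul (K := K) m ((N - 1) / 4)).not_upInjective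
    (r := N - 4 * ((N - 1) / 4)) (by omega) (by omega)
  rwa [show 4 * ((N - 1) / 4) + (N - 4 * ((N - 1) / 4)) = N by omega,
    show (N - 1) / 4 + 1 = (N + 3) / 4 by omega] at this

/-- The pairs `{3 i + o, 3 i + o + 1}` yield functionals vanishing on the image of multiplication
by the sum of the variables. -/
theorem exists_isDownKernel_lasso {m o : ℕ} (ho : o = 0 ∧ m % 3 = 0 ∨ o = 1) (t : ℕ) :
    ∃ (B : Finset ℕ) (f : Finset ℕ → K) (T : Finset ℕ), (lasso m).IsDownKernel B f ∧
      (∀ s ∈ B, s + 1 < 3 * t + o ∧ o ≤ s) ∧ T.card = t ∧ f T ≠ 0 := by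
  induction t with
  | zero =>
    refine ⟨∅, fun T => if T = ∅ then 1 else 0, ∅, ⟨fun T hT => ?_, by simp⟩, by simp, rfl,
      by simp⟩
    have : T = ∅ := by simpa using hT
    subst this
    simp [IsIndepSet]
  | succ t ih =>
    obtain ⟨B, f, T, hf, hB, hc, hne⟩ := ih
    have hTB := (hf.1 T hne).2
    have hp : 3 * t + o ∉ B := fun h => by have := hB _ h; omega
    have hq : 3 * t + o + 1 ∉ B := fun h => by have := hB _ h; omega
    have hdisj : Disjoint B {3 * t + o, 3 * t + o + 1} := by
      simp [Finset.disjoint_right, hp, hq]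
    refine ⟨_, _, insert (3 * t + o) T, hf.mul (isDownKernel_pair (p := 3 * t + o)
      (q := 3 * t + o + 1) (by omega)) hdisj (fun u hu v hv hadj => ?_), fun s hs => ?_, ?_, ?_⟩
    -- One vertex is skipped between pairs. The edge `{0, m - 1}` is harmless: either 0 is not used
    -- (`o = 1`), or `m - 1` is congruent to 2 modulo 3 and is skipped (`o = 0`).
    · have := hB u hu
      rw [lasso_adj] at hadj
      simp only [Finset.mem_insert, Finset.mem_singleton] at hv
      omega
    · simp only [Finset.mem_union, Finset.mem_insert, Finset.mem_singleton] at hs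
      rcases hs with hs | hs
      · have := hB s hs
        omega
      · omega
    · rw [Finset.card_insert_of_notMem fun h => hp (hTB h), hc]
    · have h1 : insert (3 * t + o) T ∩ B = T := by
        rw [Finset.insert_inter_of_notMem hp, Finset.inter_eq_left.2 hTB]
      have h2 : insert (3 * t + o) T ∩ {3 * t + o, 3 * t + o + 1} = {3 * t + o} := by
        rw [Finset.insert_inter_of_mem (by simp), Finset.disjoint_iff_inter_eq_empty.1
          (hdisj.mono_left hTB)]
        rfl
      rw [if_pos, h1, h2, if_pos rfl, mul_one]
      · exact hne
      · exact Finset.insert_subset (by simp) (hTB.trans Finset.subset_union_left)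

theorem not_downInjective_lasso {m o : ℕ} (ho : o = 0 ∧ m % 3 = 0 ∨ o = 1) {N j : ℕ}
    (hj : 3 * (j + 1) + o ≤ N + 1) : ¬ (lasso m).DownInjective K (Finset.range N) j := by
  obtain ⟨B, f, T, hf, hB, hc, hne⟩ := exists_isDownKernel_lasso (K := K) ho (j + 1)
  refine hf.not_downInjective (fun s hs => Finset.mem_range.2 ?_) hc hne
  have := hB s hs
  omega

/-- The pentagon with a tail of four vertices: a quadratic form annihilated by the sum of the
variables. -/
def pentagonKernel (S : Finset ℕ) : ℤ :=
  if S.card = 2 then if S ⊆ Finset.range 5 ∨ Disjoint S (Finset.range 5) then 2 else -1 else 0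

/-- Neither the pentagon nor the path on four vertices has three independent vertices. Hence an
independent triple has two vertices in one part and one in the other, and its facets contribute 2 -
1 - 1 = 0. -/
theorem isUpKernel_pentagonKernel :
    (lasso 5).IsUpKernel (Finset.range 9) fun S => (pentagonKernel S : K) := by
  intro T hT hi
  have key : ∀ T ∈ Finset.powersetCard 3 (Finset.range 9),
      (∀ u ∈ T, ∀ v ∈ T, ¬ (u + 1 = v ∨ u = 0 ∧ v = 4)) →
      ∑ v ∈ T, pentagonKernel (T.erase v) = 0 := by
    decide +kernel
  rw [← Int.cast_sum]
  by_cases hc : T.card = 3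
  · rw [key T (Finset.mem_powersetCard.2 ⟨hT, hc⟩), Int.cast_zero]
    intro u hu v hv h
    refine hi hu hv (by omega) (lasso_adj.2 ?_)
    omega
  · rw [Finset.sum_eq_zero, Int.cast_zero]
    intro v hv
    refine if_neg ?_
    rw [Finset.card_erase_of_mem hv]
    omega

theorem lassoUpKernel_pentagon [CharZero K] : LassoUpKernel K 5 9 2 := by
  refine ⟨_, {0, 2}, isUpKernel_pentagonKernel, by simp, ?_, rfl, ?_, by simp⟩
  · intro u hu v hv huv
    simp only [Finset.coe_insert, Finset.coe_singleton, Set.mem_insert_iff,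
      Set.mem_singleton_iff] at hu hv
    rw [lasso_adj]
    omega
  · rw [show pentagonKernel {0, 2} = 2 by decide +kernel]
    norm_num

theorem LassoUpKernel.not_upInjective_self {m N a : ℕ} (h : LassoUpKernel K m N a) :
    ¬ (lasso m).UpInjective K (Finset.range N) a := by
  obtain ⟨f, S, hf, hSN, hS, hc, hne, -⟩ := h
  rw [← hc]
  refine hf.not_upInjective (fun s hs => Finset.mem_range.2 ?_) hS hne
  have := hSN s hs
  omega

/-- A triangle is a clique, so the positive block of the linear form may have three vertices, and
one form covers all five. -/
theorem not_upInjective_triangle : ¬ (lasso 3).UpInjective K (Finset.range 5) 1 := by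
  have hker : (lasso 3).IsUpKernel (Finset.range 5) fun S =>
      if S.card = 1 then ∑ v ∈ S, (if v < 3 then (1 : K) else -1) else 0 := by
    refine isUpKernel_linear fun u hu v hv huv hadj => ?_
    simp only [lasso_adj, Finset.mem_range] at hu hv hadj
    by_cases h1 : u < 3 <;> by_cases h2 : v < 3
    · omega
    · simp [h1, h2]
    · simp [h1, h2]
    · omega
  exact hker.not_upInjective (S := {0}) (by simp) (by simp [IsIndepSet]) (by simp)

end LassoKernels

/-! ### Tadpoles without the weak Lefschetz property. -/

section Failure

variable {𝕜 : Type*} [Field 𝕜] [CharZero 𝕜]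

theorem not_hasWLP_tadpole {m n j : ℕ} (hm : 3 ≤ m)
    (hup : ¬ (lasso m).UpInjective 𝕜 (Finset.range (m + n)) j)
    (hdown : ¬ (lasso m).DownInjective 𝕜 (Finset.range (m + n)) j) :
    ¬ HasWLP ((tadpole m n).artinianGrading 𝕜) := fun h =>
  ((hasWLP_tadpole_iff hm n).1 h j).elim hup hdown

/-- Failure of the weak Lefschetz property for a tadpole with many vertices. -/
theorem not_hasWLP_tadpole_of_le {m n : ℕ} (hm : 3 ≤ m)
    (h : (m + n + 3) / 4 + 1 ≤ (m + n) / 3) : ¬ HasWLP ((tadpole m n).artinianGrading 𝕜) :=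
  not_hasWLP_tadpole hm (not_upInjective_lasso m (by omega))
    (not_downInjective_lasso (Or.inr rfl) (by omega))

/-- When 3 divides `m` the pairs may start at vertex 0. The vertex gained makes room for the one
missing pair. -/
theorem not_hasWLP_tadpole_two {m : ℕ} (hm : 3 < m) (h3 : m % 3 = 0) (hle : m ≤ 15) :
    ¬ HasWLP ((tadpole m 2).artinianGrading 𝕜) :=
  not_hasWLP_tadpole hm.le (not_upInjective_lasso m (by omega))
    (not_downInjective_lasso (Or.inl ⟨rfl, h3⟩) (by omega))

theorem not_hasWLP_tadpole_three_two : ¬ HasWLP ((tadpole 3 2).artinianGrading 𝕜) :=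
  not_hasWLP_tadpole le_rfl not_upInjective_triangle
    (not_downInjective_lasso (Or.inl ⟨rfl, rfl⟩) (by omega))

/-- The pentagon form has degree 2 on nine vertices, one less than ⌈9/4⌉, and each further block of
four adds one degree. Injectivity thus fails in degrees 2, 3, 4, early enough to meet the failure of
surjectivity. -/
theorem not_hasWLP_tadpole_five {n : ℕ} (hn : n = 4 ∨ n = 8 ∨ n = 12) :
    ¬ HasWLP ((tadpole 5 n).artinianGrading 𝕜) := by
  rcases hn with rfl | rfl | rfl
  · exact not_hasWLP_tadpole (by norm_num) lassoUpKernel_pentagon.not_upInjective_self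
      (not_downInjective_lasso (Or.inr rfl) (by omega))
  · exact not_hasWLP_tadpole (by norm_num) lassoUpKernel_pentagon.add_four.not_upInjective_self
      (not_downInjective_lasso (Or.inr rfl) (by omega))
  · exact not_hasWLP_tadpole (by norm_num)
      lassoUpKernel_pentagon.add_four.add_four.not_upInjective_self
      (not_downInjective_lasso (Or.inr rfl) (by omega))

end Failure

end SimpleGraph

/-! ### Verified sparse Gaussian elimination modulo 7. -/

section Elimination

instance fact_prime_seven : Fact (Nat.Prime 7) := ⟨by norm_num⟩

/-- A linear equation modulo `7`, as a list of pairs (unknown, coefficient). -/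
inductive SparseRow
  | nil
  | cons (k c : ℕ) (r : SparseRow)

/-- Evaluate `n` to a numeral before passing it to `f`. -/
noncomputable def forceNat {α : Type} (n : ℕ) (f : ℕ → α) : α :=
  Nat.rec (f 0) (fun m _ => f (Nat.succ m)) n

theorem forceNat_eq {α : Type} (n : ℕ) (f : ℕ → α) : forceNat n f = f n := by
  cases n <;> rfl

/-- Case distinction on a Boolean, in a form that reduces quickly. -/
@[reducible]
def boolCase {α : Type} (b : Bool) (x y : α) : α := Bool.rec y x b

theorem boolCase_eq {α : Type} (b : Bool) (x y : α) : boolCase b x y = if b then x else y := by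
  cases b <;> rfl

namespace SparseRow

/-- The left-hand side of the equation at an assignment of the unknowns. -/
def eval (f : ℕ → ZMod 7) : SparseRow → ZMod 7
  | nil => 0
  | cons k c r => c * f k + eval f r

/-- Prepend the reversal of `r`. -/
noncomputable def revOnto (r : SparseRow) : SparseRow → SparseRow :=
  r.rec id fun k c _ ih acc => ih (cons k c acc)

/-- Multiply by `a`, and prepend the reversal of the accumulator. -/
noncomputable def scaleOnto (a : ℕ) (r : SparseRow) : SparseRow → SparseRow :=
  r.rec (fun acc => acc.revOnto nil) fun k c _ ih acc =>
    forceNat (Nat.mod (Nat.mul a c) (nat_lit 7)) fun c => ih (cons k c acc)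

/-- The combination `a r + b s` of two equations with decreasing unknowns. -/
noncomputable def comb (a b : ℕ) (r : SparseRow) : SparseRow → SparseRow → SparseRow :=
  r.rec (fun s acc => scaleOnto b s acc) fun k x r ih s =>
    s.rec (fun acc => scaleOnto a (cons k x r) acc) fun l y s ih' acc =>
      boolCase (Nat.ble (Nat.succ l) k)
        (forceNat (Nat.mod (Nat.mul a x) (nat_lit 7)) fun c => ih (cons l y s) (cons k c acc))
        (boolCase (Nat.ble (Nat.succ k) l)
          (forceNat (Nat.mod (Nat.mul b y) (nat_lit 7)) fun c => ih' (cons l c acc))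
          (forceNat (Nat.mod (Nat.add (Nat.mul a x) (Nat.mul b y)) (nat_lit 7)) fun c =>
            boolCase (Nat.beq c (nat_lit 0)) (ih s acc) (ih s (cons k c acc))))

/-- All unknowns are smaller than `u`. -/
noncomputable def allLt (u : ℕ) (r : SparseRow) : Bool :=
  r.rec true fun k _ _ ih => boolCase (Nat.ble (Nat.succ k) u) ih false

/-- The equation determines the unknown `u` in terms of smaller ones. -/
noncomputable def isPivot (u : ℕ) (r : SparseRow) : Bool :=
  r.rec false fun k c r _ => boolCase (Nat.beq k u)
    (boolCase (Nat.beq (Nat.mod c (nat_lit 7)) (nat_lit 0)) false (r.allLt u)) false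

variable (f : ℕ → ZMod 7)

theorem eval_revOnto (r acc : SparseRow) : (r.revOnto acc).eval f = r.eval f + acc.eval f := by
  induction r generalizing acc with
  | nil => exact (zero_add _).symm
  | cons k c r ih =>
    refine (ih _).trans ?_
    simp only [eval]
    ring

theorem natCast_mod_seven (n : ℕ) : ((Nat.mod n (nat_lit 7) : ℕ) : ZMod 7) = n :=
  ZMod.natCast_mod n 7

theorem eval_scaleOnto (a : ℕ) (r acc : SparseRow) :
    (r.scaleOnto a acc).eval f = a * r.eval f + acc.eval f := by
  induction r generalizing acc with
  | nil =>
    refine (eval_revOnto f acc nil).trans ?_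
    simp [eval]
  | cons k c r ih =>
    change (forceNat (Nat.mod (Nat.mul a c) (nat_lit 7)) fun c =>
      scaleOnto a r (cons k c acc)).eval f = _
    rw [forceNat_eq, ih]
    simp only [eval, natCast_mod_seven]
    simp only [Nat.mul_eq, Nat.cast_mul]
    ring

/-- Valid for arbitrary rows: decreasing order only matters for finding cancellations, so no
sortedness invariant is carried. -/
theorem eval_comb (a b : ℕ) (r s acc : SparseRow) :
    (comb a b r s acc).eval f = a * r.eval f + b * s.eval f + acc.eval f := by
  induction r generalizing s acc with
  | nil =>
    refine (eval_scaleOnto f b s acc).trans ?_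
    simp [eval]
  | cons k x r ih =>
    induction s generalizing acc with
    | nil =>
      change (scaleOnto a (cons k x r) acc).eval f = _
      rw [eval_scaleOnto]
      simp [eval]
    | cons l y s ih' =>
      change (boolCase (Nat.ble (Nat.succ l) k)
        (forceNat (Nat.mod (Nat.mul a x) (nat_lit 7)) fun c =>
          comb a b r (cons l y s) (cons k c acc))
        (boolCase (Nat.ble (Nat.succ k) l)
          (forceNat (Nat.mod (Nat.mul b y) (nat_lit 7)) fun c =>
            comb a b (cons k x r) s (cons l c acc))
          (forceNat (Nat.mod (Nat.add (Nat.mul a x) (Nat.mul b y)) (nat_lit 7)) fun c =>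
            boolCase (Nat.beq c (nat_lit 0)) (comb a b r s acc)
              (comb a b r s (cons k c acc))))).eval f = _
      simp only [forceNat_eq, boolCase_eq]
      split_ifs with h1 h2 h3
      · rw [ih]
        simp only [eval, natCast_mod_seven]
        simp only [Nat.mul_eq, Nat.cast_mul]
        ring
      · rw [ih']
        simp only [eval, natCast_mod_seven]
        simp only [Nat.mul_eq, Nat.cast_mul]
        ring
      · have hkl : k = l := by
          rw [Nat.ble_eq] at h1 h2
          omega
        have h0 := congrArg (Nat.cast (R := ZMod 7)) (Nat.eq_of_beq_eq_true h3)
        rw [natCast_mod_seven] at h0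
        simp only [Nat.mul_eq, Nat.add_eq, Nat.cast_add, Nat.cast_mul] at h0
        rw [ih, hkl]
        simp only [eval]
        linear_combination -(f l) * h0
      · have hkl : k = l := by
          rw [Nat.ble_eq] at h1 h2
          omega
        rw [ih, hkl]
        simp only [eval, natCast_mod_seven]
        simp only [Nat.mul_eq, Nat.add_eq, Nat.cast_add, Nat.cast_mul]
        ring

theorem eval_eq_zero_of_allLt {u : ℕ} (hf : ∀ k < u, f k = 0) {r : SparseRow}
    (h : r.allLt u = true) : r.eval f = 0 := by
  induction r with
  | nil => rfl
  | cons k c r ih =>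
    change boolCase (Nat.ble (Nat.succ k) u) (r.allLt u) false = true at h
    rw [boolCase_eq] at h
    split_ifs at h with hk
    rw [eval, hf k (Nat.le_of_ble_eq_true hk), mul_zero, zero_add, ih h]

theorem eq_zero_of_isPivot {u : ℕ} (hf : ∀ k < u, f k = 0) {r : SparseRow}
    (hr : r.eval f = 0) (h : r.isPivot u = true) : f u = 0 := by
  cases r with
  | nil => exact absurd h Bool.false_ne_true
  | cons k c r =>
    change boolCase (Nat.beq k u) (boolCase (Nat.beq (Nat.mod c (nat_lit 7)) (nat_lit 0)) false
      (r.allLt u)) false = true at h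
    simp only [boolCase_eq] at h
    split_ifs at h with hk hc
    have hk := Nat.eq_of_beq_eq_true hk
    subst hk
    rw [eval, eval_eq_zero_of_allLt f hf h, add_zero] at hr
    refine (mul_eq_zero.1 hr).resolve_left fun h0 => hc ?_
    rw [ZMod.natCast_eq_zero_iff] at h0
    rw [Nat.beq_eq]
    exact Nat.mod_eq_zero_of_dvd h0

end SparseRow

/-- Prepend the reversal of a list of equations. -/
noncomputable def revOntoRows (l : List SparseRow) : List SparseRow → List SparseRow :=
  l.rec id fun p _ ih acc => ih (p :: acc)

/-- Reduce an equation by a list of equations with decreasing leading unknowns, insert the result,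
and pass on the new list. -/
noncomputable def insertRow (ps : List SparseRow) :
    SparseRow → List SparseRow → (List SparseRow → Bool) → Bool :=
  ps.rec
    (fun row acc cont => row.rec (cont (revOntoRows acc []))
      fun k c r _ => cont (revOntoRows acc [.cons k c r]))
    fun p ps ih row acc cont => row.rec (cont (revOntoRows acc (p :: ps))) fun k c r _ =>
      p.rec (cont []) fun l d _ _ =>
        boolCase (Nat.ble (Nat.succ k) l) (ih (.cons k c r) (p :: acc) cont)
          (boolCase (Nat.ble (Nat.succ l) k) (cont (revOntoRows acc (.cons k c r :: p :: ps)))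
            (ih (.comb d (Nat.sub (nat_lit 7) c) (.cons k c r) p .nil) (p :: acc) cont))

/-- The equations determine the unknowns `us` one after the other. -/
noncomputable def allPivots (us : List ℕ) : List SparseRow → Bool :=
  us.rec (fun _ => true) fun u _ ih ps =>
    ps.rec false fun p ps _ => boolCase (p.isPivot u) (ih ps) false

/-- Gaussian elimination modulo `7`: do the equations `rows` in the unknowns `us` have only the
trivial solution? -/
noncomputable def solveRows (us : List ℕ) (rows : List SparseRow) : List SparseRow → Bool :=
  rows.rec (allPivots us) fun row _ ih ps => insertRow ps row [] ih

theorem mem_revOntoRows {l acc : List SparseRow} {p : SparseRow} :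
    p ∈ revOntoRows l acc ↔ p ∈ l ∨ p ∈ acc := by
  induction l generalizing acc with
  | nil => simp [revOntoRows]
  | cons q l ih =>
    refine ih.trans ?_
    simp only [List.mem_cons]
    tauto

/-- The only invariant is that `f` solves every stored equation. Dropping equations is therefore
sound, which covers the degenerate branch passing on `[]`. -/
theorem exists_of_insertRow {f : ℕ → ZMod 7} {ps : List SparseRow} {row : SparseRow}
    {acc : List SparseRow} {cont : List SparseRow → Bool} (h : insertRow ps row acc cont = true)
    (hps : ∀ p ∈ ps, p.eval f = 0) (hrow : row.eval f = 0) (hacc : ∀ p ∈ acc, p.eval f = 0) :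
    ∃ qs, (∀ q ∈ qs, q.eval f = 0) ∧ cont qs = true := by
  induction ps generalizing row acc with
  | nil =>
    cases row with
    | nil => exact ⟨_, fun q hq => by simpa [mem_revOntoRows] using hacc q (by
        simpa [mem_revOntoRows] using hq), h⟩
    | cons k c r =>
      refine ⟨_, fun q hq => ?_, h⟩
      rw [mem_revOntoRows, List.mem_singleton] at hq
      rcases hq with hq | rfl
      · exact hacc q hq
      · exact hrow
  | cons p ps ih =>
    have hp := hps p List.mem_cons_self
    have hps' : ∀ q ∈ ps, q.eval f = 0 := fun q hq => hps q (List.mem_cons_of_mem p hq)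
    have hacc' : ∀ q ∈ p :: acc, q.eval f = 0 := by
      simpa using ⟨hp, hacc⟩
    cases row with
    | nil =>
      refine ⟨_, fun q hq => ?_, h⟩
      rw [mem_revOntoRows] at hq
      exact hq.elim (hacc q) (hps q)
    | cons k c r =>
      cases p with
      | nil => exact ⟨[], by simp, h⟩
      | cons l d p =>
        change boolCase (Nat.ble (Nat.succ k) l) (insertRow ps (.cons k c r) (_ :: acc) cont)
          (boolCase (Nat.ble (Nat.succ l) k) (cont (revOntoRows acc (.cons k c r :: _ :: ps)))
            (insertRow ps (.comb d (Nat.sub (nat_lit 7) c) (.cons k c r) (.cons l d p) .nil)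
              (_ :: acc) cont)) = true at h
        simp only [boolCase_eq] at h
        split_ifs at h
        · exact ih h hps' hrow hacc'
        · refine ⟨_, fun q hq => ?_, h⟩
          rw [mem_revOntoRows, List.mem_cons] at hq
          rcases hq with hq | rfl | hq
          · exact hacc q hq
          · exact hrow
          · exact hps q hq
        -- The multipliers `d` and `7 - c` are meant to cancel the common leading unknown; soundness
        -- only needs a combination of two valid equations.
        · refine ih h hps' ?_ hacc'
          rw [SparseRow.eval_comb, hrow, hp]
          simp [SparseRow.eval]

theorem exists_isPivot_of_allPivots {us : List ℕ} {ps : List SparseRow}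
    (h : allPivots us ps = true) {u : ℕ} (hu : u ∈ us) : ∃ p ∈ ps, p.isPivot u = true := by
  induction us generalizing ps with
  | nil => simp at hu
  | cons v us ih =>
    cases ps with
    | nil => exact absurd h Bool.false_ne_true
    | cons p ps =>
      change boolCase (p.isPivot v) (allPivots us ps) false = true at h
      rw [boolCase_eq] at h
      split_ifs at h with hp
      rcases List.mem_cons.1 hu with rfl | hu
      · exact ⟨p, List.mem_cons_self, hp⟩
      · obtain ⟨q, hq, hqu⟩ := ih h hu
        exact ⟨q, List.mem_cons_of_mem p hq, hqu⟩

theorem eq_zero_of_solveRows {f : ℕ → ZMod 7} {us : List ℕ} {rows ps : List SparseRow}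
    (h : solveRows us rows ps = true) (hus : ∀ k, k ∉ us → f k = 0)
    (hrows : ∀ r ∈ rows, r.eval f = 0) (hps : ∀ p ∈ ps, p.eval f = 0) (k : ℕ) : f k = 0 := by
  induction rows generalizing ps with
  | nil =>
    -- The pivot row of `k` expresses `f k` through smaller unknowns, already known to vanish.
    induction k using Nat.strong_induction_on with
    | _ k ih =>
      by_cases hk : k ∈ us
      · obtain ⟨p, hp, hpk⟩ := exists_isPivot_of_allPivots h hk
        exact SparseRow.eq_zero_of_isPivot f ih (hps p hp) hpk
      · exact hus k hk
  | cons row rows ih =>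
    obtain ⟨qs, hqs, hcont⟩ := exists_of_insertRow h hps (hrows row List.mem_cons_self) (by simp)
    exact ih hcont (fun r hr => hrows r (List.mem_cons_of_mem _ hr)) hqs

end Elimination

namespace SimpleGraph

/-! ### Deleting a vertex or its closed neighborhood. -/

section Splitting

variable {V : Type*} [DecidableEq V] {G : SimpleGraph V} {K : Type*} [Field K] {W W' : Finset V}
  {j : ℕ} {v : V}

theorem isIndepSet_insert_iff {S : Finset V} :
    G.IsIndepSet (insert v S : Finset V) ↔ G.IsIndepSet (S : Set V) ∧ ∀ u ∈ S, ¬ G.Adj v u := by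
  have : Std.Symm fun u v => ¬ G.Adj u v := ⟨fun u v h h' => h h'.symm⟩
  rw [Finset.coe_insert, IsIndepSet, Set.pairwise_insert_of_symm]
  refine and_congr_right fun _ => ⟨fun h u hu hadj => h u hu hadj.ne hadj, fun h u hu _ => h u hu⟩

/-- Injectivity on `A(G)` follows from injectivity on `A(G ∖ v)` and on `A(G ∖ N[v])`. -/
theorem UpInjective.split (hv : v ∈ W)
    (hW' : ∀ u, u ∈ W' ↔ u ∈ W ∧ u ≠ v ∧ ¬ G.Adj v u)
    (h1 : G.UpInjective K (W.erase v) (j + 1)) (h2 : G.UpInjective K W' j) :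
    G.UpInjective K W (j + 1) := by
  intro f hf
  have hzero : ∀ S ⊆ W.erase v, G.IsIndepSet (S : Set V) → S.card = j + 1 → f S = 0 :=
    h1 f fun T hT hi hc => hf T (hT.trans (Finset.erase_subset v W)) hi hc
  have hW'W : W' ⊆ W.erase v := fun u hu => by
    have := (hW' u).1 hu
    simp [this.1, this.2.1]
  have hvW' : v ∉ W' := fun h => ((hW' v).1 h).2.1 rfl
  have hins {T : Finset V} (hT : T ⊆ W') (hi : G.IsIndepSet (T : Set V)) :
      G.IsIndepSet (insert v T : Finset V) :=
    isIndepSet_insert_iff.2 ⟨hi, fun u hu => ((hW' u).1 (hT hu)).2.2⟩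
  -- With the part avoiding `v` gone, `f` is `x_v` times an element of A(G ∖ N[v]), to which the
  -- second hypothesis applies.
  have hlink := h2 (fun S => f (insert v S)) fun T hT hi hc => by
    have hvT : v ∉ T := fun h => hvW' (hT h)
    have := hf (insert v T)
      (Finset.insert_subset hv ((hT.trans hW'W).trans (Finset.erase_subset v W))) (hins hT hi)
      (by rw [Finset.card_insert_of_notMem hvT, hc])
    rw [Finset.sum_insert hvT, Finset.erase_insert hvT, hzero T (hT.trans hW'W) hi hc,
      zero_add] at this
    rw [← this]
    refine Finset.sum_congr rfl fun u hu => ?_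
    rw [Finset.erase_insert_of_ne (ne_of_mem_of_not_mem hu hvT).symm]
  intro S hSW hS hc
  by_cases hvS : v ∈ S
  · have := hlink (S.erase v) (fun u hu => (hW' u).2 ?_) (hS.erase v)
      (by rw [Finset.card_erase_of_mem hvS]; omega)
    · simpa only [Finset.insert_erase hvS] using this
    · obtain ⟨hne, hu⟩ := Finset.mem_erase.1 hu
      exact ⟨hSW hu, hne, hS hvS hu hne.symm⟩
  · exact hzero S (fun u hu => Finset.mem_erase.2 ⟨fun h => hvS (h ▸ hu), hSW hu⟩) hS hc

/-- Surjectivity on `A(G)` follows from surjectivity on `A(G ∖ v)` and on `A(G ∖ N[v])`. -/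
theorem DownInjective.split (hv : v ∈ W)
    (hW' : ∀ u, u ∈ W' ↔ u ∈ W ∧ u ≠ v ∧ ¬ G.Adj v u)
    (h1 : G.DownInjective K (W.erase v) (j + 1)) (h2 : G.DownInjective K W' j) :
    G.DownInjective K W (j + 1) := by
  intro f hf0 hf
  have hW'W : W' ⊆ W := fun u hu => ((hW' u).1 hu).1
  have hvW' : v ∉ W' := fun h => ((hW' v).1 h).2.1 rfl
  have hins {T : Finset V} (hT : T ⊆ W') (hi : G.IsIndepSet (T : Set V)) :
      G.IsIndepSet (insert v T : Finset V) :=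
    isIndepSet_insert_iff.2 ⟨hi, fun u hu => ((hW' u).1 (hT hu)).2.2⟩
  -- Dually, the order is reversed: the functional first vanishes on multiples of `x_v`, and then
  -- descends to A(G ∖ v).
  have hlink := h2 (fun S => f (insert v S))
    (fun T hT => hf0 _ fun h => hT (isIndepSet_insert_iff.1 h).1) fun S hS hi hc => by
      have hvS : v ∉ S := fun h => hvW' (hS h)
      rw [← hf (insert v S) (Finset.insert_subset hv (hS.trans hW'W)) (hins hS hi)
        (by rw [Finset.card_insert_of_notMem hvS, hc])]
      have hsub : W' \ S ⊆ W \ insert v S := fun u hu => by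
        rw [Finset.mem_sdiff] at hu
        have := (hW' u).1 hu.1
        simp [this.1, this.2.1, hu.2]
      rw [← Finset.sum_subset hsub]
      · exact Finset.sum_congr rfl fun u _ => by rw [Finset.insert_comm]
      · intro u hu hu'
        refine hf0 _ fun hi => hu' ?_
        simp only [Finset.mem_sdiff, Finset.mem_insert, not_or] at hu ⊢
        refine ⟨(hW' u).2 ⟨hu.1, hu.2.1, fun h => ?_⟩, hu.2.2⟩
        exact (isIndepSet_insert_iff.1 hi).2 v (Finset.mem_insert_self v S) h.symm
  have hlink' (S : Finset V) (hS : S ⊆ W) (hvS : v ∉ S) (hc : S.card = j + 1) :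
      f (insert v S) = 0 := by
    by_cases hi : G.IsIndepSet (insert v S : Finset V)
    · obtain ⟨hiS, hadj⟩ := isIndepSet_insert_iff.1 hi
      exact hlink S (fun u hu => (hW' u).2 ⟨hS hu, fun h => hvS (h ▸ hu), hadj u hu⟩) hiS hc
    · exact hf0 _ hi
  have hzero := h1 f hf0 fun S hS hi hc => by
    have hvS : v ∉ S := fun h => by simpa using hS h
    have hSW := hS.trans (Finset.erase_subset v W)
    have := hf S hSW hi hc
    rw [← Finset.add_sum_erase _ _ (Finset.mem_sdiff.2 ⟨hv, hvS⟩), hlink' S hSW hvS hc,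
      zero_add] at this
    rw [← this, Finset.erase_sdiff_comm]
  intro T hTW hT hc
  by_cases hvT : v ∈ T
  · have := hlink' (T.erase v) ((Finset.erase_subset v T).trans hTW) (Finset.notMem_erase v T)
      (by rw [Finset.card_erase_of_mem hvT]; omega)
    rwa [Finset.insert_erase hvT] at this
  · exact hzero T (fun u hu => Finset.mem_erase.2 ⟨fun h => hvT (h ▸ hu), hTW hu⟩) hT hc

end Splitting

/-! ### Listing independent sets and writing down the linear systems. -/

section Enumeration

/-- Two vertices of the infinite tadpole graph are equal or adjacent. -/
def lassoNear (m a b : ℕ) : Bool :=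
  (Nat.ble a (Nat.succ b) && Nat.ble b (Nat.succ a)) ||
    ((Nat.beq a 0 && Nat.beq (Nat.succ b) m) || (Nat.beq b 0 && Nat.beq (Nat.succ a) m))

theorem lassoNear_eq_false_iff {m a b : ℕ} :
    lassoNear m a b = false ↔ a ≠ b ∧ ¬ (lasso m).Adj a b := by
  rw [lasso_adj, ← Bool.not_eq_true]
  simp only [lassoNear, Bool.or_eq_true, Bool.and_eq_true, Nat.ble_eq, Nat.beq_eq,
    Nat.succ_eq_add_one]
  omega

/-- The independent sets with `j` elements among the vertices in a list. -/
def indepLists (m : ℕ) : ℕ → List ℕ → List (List ℕ)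
  | 0, _ => [[]]
  | j + 1, W => W.rec [] fun v W ih =>
      ((indepLists m j (W.filter fun u => !lassoNear m v u)).map (v :: ·)) ++ ih

theorem pairwise_of_mem_indepLists {m j : ℕ} {W L : List ℕ} (h : L ∈ indepLists m j W) :
    L.Pairwise (fun a b => lassoNear m a b = false) ∧ L ⊆ W ∧ L.length = j := by
  induction j generalizing W L with
  | zero =>
    rw [indepLists, List.mem_singleton] at h
    simp [h]
  | succ j ih =>
    induction W with
    | nil => exact absurd h List.not_mem_nil
    | cons v W ihW =>
      rcases List.mem_append.1 h with h | h
      · obtain ⟨L, hL, rfl⟩ := List.mem_map.1 h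
        obtain ⟨h1, h2, h3⟩ := ih hL
        refine ⟨List.pairwise_cons.2 ⟨fun u hu => ?_, h1⟩, ?_, by simp [h3]⟩
        · simpa using (List.mem_filter.1 (h2 hu)).2
        · exact List.cons_subset_cons v (List.Subset.trans h2 (List.filter_subset_self _))
      · obtain ⟨h1, h2, h3⟩ := ihW h
        exact ⟨h1, List.subset_cons_of_subset v h2, h3⟩

theorem nodup_of_pairwise {m : ℕ} {L : List ℕ}
    (h : L.Pairwise fun a b => lassoNear m a b = false) : L.Nodup :=
  h.imp fun h => (lassoNear_eq_false_iff.1 h).1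

theorem isIndepSet_of_pairwise {m : ℕ} {L : List ℕ}
    (h : L.Pairwise fun a b => lassoNear m a b = false) :
    (lasso m).IsIndepSet (L.toFinset : Set ℕ) := by
  have h' : L.Pairwise fun a b => ¬ (lasso m).Adj a b :=
    h.imp fun h => (lassoNear_eq_false_iff.1 h).2
  have : Std.Symm fun a b => ¬ (lasso m).Adj a b := ⟨fun _ _ h h' => h h'.symm⟩
  intro a ha b hb hab
  exact h'.forall (by simpa using ha) (by simpa using hb) hab

theorem exists_mem_indepLists {m j : ℕ} {W : List ℕ} {S : Finset ℕ} (hSW : S ⊆ W.toFinset)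
    (hS : (lasso m).IsIndepSet (S : Set ℕ)) (hc : S.card = j) :
    ∃ L ∈ indepLists m j W, L.toFinset = S := by
  induction j generalizing W S with
  | zero => exact ⟨[], by simp [indepLists], by simp [Finset.card_eq_zero.1 hc]⟩
  | succ j ih =>
    induction W with
    | nil =>
      have : S = ∅ := by simpa using hSW
      simp [this] at hc
    | cons v W ihW =>
      by_cases hv : v ∈ S
      · obtain ⟨L, hL, hLS⟩ := ih (W := W.filter fun u => !lassoNear m v u) (S := S.erase v)
          (fun u hu => by
            obtain ⟨hne, hu⟩ := Finset.mem_erase.1 hu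
            have h1 := hSW hu
            have h2 : lassoNear m v u = false :=
              lassoNear_eq_false_iff.2 ⟨hne.symm, hS hv hu hne.symm⟩
            simp only [List.toFinset_cons, Finset.mem_insert, hne, false_or,
              List.mem_toFinset] at h1
            simp [h1, h2]) (hS.erase v) (by rw [Finset.card_erase_of_mem hv]; omega)
        refine ⟨v :: L, List.mem_append.2 (Or.inl (List.mem_map.2 ⟨L, hL, rfl⟩)), ?_⟩
        rw [List.toFinset_cons, hLS, Finset.insert_erase hv]
      · obtain ⟨L, hL, hLS⟩ := ihW fun u hu => by
          have := hSW hu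
          rw [List.toFinset_cons, Finset.mem_insert] at this
          exact this.resolve_left fun h => hv (h ▸ hu)
        exact ⟨L, List.mem_append.2 (Or.inr hL), hLS⟩

/-- The binary code of a finite set of natural numbers. -/
noncomputable def listCode (L : List ℕ) : ℕ :=
  L.rec (nat_lit 0) fun v _ ih => Nat.add (Nat.pow (nat_lit 2) v) ih

theorem listCode_eq {L : List ℕ} (h : L.Nodup) : listCode L = ∑ v ∈ L.toFinset, 2 ^ v := by
  induction L with
  | nil => rfl
  | cons v L ih =>
    obtain ⟨hv, hL⟩ := List.nodup_cons.1 h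
    rw [List.toFinset_cons, Finset.sum_insert (by simpa using hv), ← ih hL]
    rfl

/-- Prepend the sum of the unknowns obtained from `c` by deleting one element of `T`, in reverse
order. -/
noncomputable def deletionsOnto (T : List ℕ) : ℕ → SparseRow → SparseRow :=
  T.rec (fun _ acc => acc) fun v _ ih c acc =>
    forceNat (Nat.sub c (Nat.pow (nat_lit 2) v)) fun k => ih c (.cons k (nat_lit 1) acc)

/-- The equation attached to an independent set `T`: the sum over its facets vanishes. -/
noncomputable def facetRow (T : List ℕ) : SparseRow :=
  deletionsOnto T (listCode T) .nil

/-- The equation attached to an independent set `S`: the sum over its extensions in `W`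
vanishes. -/
noncomputable def extensionRow (m : ℕ) (W S : List ℕ) : SparseRow :=
  (W.filter fun u => S.all fun v => !lassoNear m u v).foldr (fun u r =>
    forceNat (Nat.add (listCode S) (Nat.pow (nat_lit 2) u)) fun k => .cons k (nat_lit 1) r) .nil

theorem eval_deletionsOnto (f : ℕ → ZMod 7) (T : List ℕ) (c : ℕ) (acc : SparseRow) :
    (deletionsOnto T c acc).eval f = (T.map fun v => f (c - 2 ^ v)).sum + acc.eval f := by
  induction T generalizing acc with
  | nil => exact (zero_add _).symm
  | cons v T ih =>
    change (forceNat (Nat.sub c (Nat.pow (nat_lit 2) v)) fun k =>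
      deletionsOnto T c (.cons k (nat_lit 1) acc)).eval f = _
    rw [forceNat_eq, ih, SparseRow.eval, List.map_cons, List.sum_cons, Nat.cast_one, one_mul,
      Nat.sub_eq, Nat.pow_eq]
    ring

theorem eval_facetRow (f : ℕ → ZMod 7) (T : List ℕ) :
    (facetRow T).eval f = (T.map fun v => f (listCode T - 2 ^ v)).sum :=
  (eval_deletionsOnto f T _ _).trans (add_zero _)

theorem eval_extensionRow (f : ℕ → ZMod 7) (m : ℕ) (W S : List ℕ) :
    (extensionRow m W S).eval f = ((W.filter fun u => S.all fun v => !lassoNear m u v).map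
      fun u => f (listCode S + 2 ^ u)).sum := by
  rw [extensionRow]
  generalize W.filter _ = L
  induction L with
  | nil => rfl
  | cons u L ih =>
    rw [List.foldr_cons, forceNat_eq, SparseRow.eval, ih, List.map_cons, List.sum_cons,
      Nat.cast_one, one_mul]
    rfl

/-- Is multiplication by the sum of the variables in `W` injective in degree `j` modulo `7`? -/
noncomputable def checkUp (m : ℕ) (W : List ℕ) (j : ℕ) : Bool :=
  solveRows ((indepLists m j W).map listCode) ((indepLists m (j + 1) W).map facetRow) []

/-- Is multiplication by the sum of the variables in `W` surjective in degree `j + 1` modulo `7`? -/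
noncomputable def checkDown (m : ℕ) (W : List ℕ) (j : ℕ) : Bool :=
  solveRows ((indepLists m (j + 1) W).map listCode)
    ((indepLists m j W).map (extensionRow m W)) []

theorem upInjective_of_checkUp {m : ℕ} {W : List ℕ} {j : ℕ} (h : checkUp m W j = true) :
    (lasso m).UpInjective (ZMod 7) W.toFinset j := by
  classical
  intro f hf S hSW hS hc
  -- Unknowns are indexed by binary codes of sets; extension by zero makes all irrelevant unknowns
  -- vanish.
  let F : ℕ → ZMod 7 := fun k =>
    if k.bitIndices.toFinset ⊆ W.toFinset ∧ (lasso m).IsIndepSet (k.bitIndices.toFinset : Set ℕ) ∧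
      k.bitIndices.toFinset.card = j then f k.bitIndices.toFinset else 0
  have hF (S : Finset ℕ) (hSW : S ⊆ W.toFinset) (hS : (lasso m).IsIndepSet (S : Set ℕ))
      (hc : S.card = j) : F (∑ v ∈ S, 2 ^ v) = f S := by
    simp only [F, Finset.toFinset_bitIndices_sum_two_pow]
    exact if_pos ⟨hSW, hS, hc⟩
  rw [← hF S hSW hS hc]
  refine eq_zero_of_solveRows (f := F) h (fun k hk => if_neg fun hk' => hk ?_) (fun r hr => ?_)
    (by simp) _
  · obtain ⟨L, hL, hLk⟩ := exists_mem_indepLists hk'.1 hk'.2.1 hk'.2.2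
    refine List.mem_map.2 ⟨L, hL, ?_⟩
    rw [listCode_eq (nodup_of_pairwise (pairwise_of_mem_indepLists hL).1), hLk,
      Finset.sum_toFinset_bitIndices_two_pow]
  · obtain ⟨T, hT, rfl⟩ := List.mem_map.1 hr
    obtain ⟨hp, hTW, hlen⟩ := pairwise_of_mem_indepLists hT
    have hnd := nodup_of_pairwise hp
    have hTW' : T.toFinset ⊆ W.toFinset := fun u hu => by
      simpa using hTW (by simpa using hu)
    have hTi := isIndepSet_of_pairwise hp
    have hTc : T.toFinset.card = j + 1 := by rw [List.toFinset_card_of_nodup hnd, hlen]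
    rw [eval_facetRow, ← List.sum_toFinset _ hnd, ← hf T.toFinset hTW' hTi hTc]
    refine Finset.sum_congr rfl fun v hv => ?_
    rw [listCode_eq hnd, ← Finset.add_sum_erase _ _ hv, Nat.add_sub_cancel_left]
    exact hF _ ((Finset.erase_subset v _).trans hTW') (hTi.erase v)
      (by rw [Finset.card_erase_of_mem hv]; omega)

theorem downInjective_of_checkDown {m : ℕ} {W : List ℕ} (hW : W.Nodup) {j : ℕ}
    (h : checkDown m W j = true) : (lasso m).DownInjective (ZMod 7) W.toFinset j := by
  classical
  intro f hf0 hf S hSW hS hc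
  -- Independence need not be imposed, since `f` already vanishes on dependent sets.
  let F : ℕ → ZMod 7 := fun k =>
    if k.bitIndices.toFinset ⊆ W.toFinset ∧ k.bitIndices.toFinset.card = j + 1 then
      f k.bitIndices.toFinset else 0
  have hF (S : Finset ℕ) (hSW : S ⊆ W.toFinset) (hc : S.card = j + 1) :
      F (∑ v ∈ S, 2 ^ v) = f S := by
    simp only [F, Finset.toFinset_bitIndices_sum_two_pow]
    exact if_pos ⟨hSW, hc⟩
  rw [← hF S hSW hc]
  refine eq_zero_of_solveRows (f := F) h (fun k hk => ?_) (fun r hr => ?_) (by simp) _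
  · by_contra hne
    have hk' : k.bitIndices.toFinset ⊆ W.toFinset ∧ k.bitIndices.toFinset.card = j + 1 := by
      by_contra hn
      exact hne (if_neg hn)
    have hi : (lasso m).IsIndepSet (k.bitIndices.toFinset : Set ℕ) := by
      by_contra hn
      exact hne ((if_pos hk').trans (hf0 _ hn))
    obtain ⟨L, hL, hLk⟩ := exists_mem_indepLists hk'.1 hi hk'.2
    refine hk (List.mem_map.2 ⟨L, hL, ?_⟩)
    rw [listCode_eq (nodup_of_pairwise (pairwise_of_mem_indepLists hL).1), hLk,
      Finset.sum_toFinset_bitIndices_two_pow]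
  · obtain ⟨T, hT, rfl⟩ := List.mem_map.1 hr
    obtain ⟨hp, hTW, hlen⟩ := pairwise_of_mem_indepLists hT
    have hnd := nodup_of_pairwise hp
    have hTW' : T.toFinset ⊆ W.toFinset := fun u hu => by
      simpa using hTW (by simpa using hu)
    have hTi := isIndepSet_of_pairwise hp
    have hTc : T.toFinset.card = j := by rw [List.toFinset_card_of_nodup hnd, hlen]
    have hmem (u : ℕ) : (T.all fun v => !lassoNear m u v) = true ↔
        u ∉ T.toFinset ∧ ∀ v ∈ T.toFinset, ¬ (lasso m).Adj u v := by
      simp only [List.all_eq_true, Bool.not_eq_true', lassoNear_eq_false_iff, List.mem_toFinset]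
      exact ⟨fun h => ⟨fun hu => (h u hu).1 rfl, fun v hv => (h v hv).2⟩,
        fun h v hv => ⟨fun huv => h.1 (huv ▸ hv), h.2 v hv⟩⟩
    rw [eval_extensionRow, ← List.sum_toFinset _ (hW.filter _), ← hf T.toFinset hTW' hTi hTc]
    refine Eq.trans (Finset.sum_congr rfl fun u hu => ?_) (Finset.sum_subset (fun u hu => ?_)
      fun u hu hu' => hf0 _ fun hi => hu' ?_)
    · rw [List.mem_toFinset, List.mem_filter, hmem] at hu
      rw [listCode_eq hnd, add_comm, ← Finset.sum_insert hu.2.1]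
      exact hF _ (Finset.insert_subset (by simpa using hu.1) hTW')
        (by rw [Finset.card_insert_of_notMem hu.2.1, hTc])
    · rw [List.mem_toFinset, List.mem_filter, hmem] at hu
      exact Finset.mem_sdiff.2 ⟨by simpa using hu.1, hu.2.1⟩
    · rw [Finset.mem_sdiff, List.mem_toFinset] at hu
      rw [List.mem_toFinset, List.mem_filter, hmem]
      exact ⟨hu.1, hu.2, (isIndepSet_insert_iff.1 hi).2⟩

/-- Can every independent set with `j` elements be enlarged inside `W`? -/
def checkExtendable (m : ℕ) (W : List ℕ) (j : ℕ) : Bool :=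
  (indepLists m j W).all fun S => W.any fun u => S.all fun v => !lassoNear m u v

theorem exists_insert_of_checkExtendable {m : ℕ} {W : List ℕ} {j : ℕ}
    (h : checkExtendable m W j = true) (S : Finset ℕ) (hSW : S ⊆ W.toFinset)
    (hS : (lasso m).IsIndepSet (S : Set ℕ)) (hc : S.card = j) :
    ∃ v ∈ W.toFinset, v ∉ S ∧ (lasso m).IsIndepSet (insert v S : Finset ℕ) := by
  obtain ⟨L, hL, rfl⟩ := exists_mem_indepLists hSW hS hc
  obtain ⟨u, hu, huL⟩ := List.any_eq_true.1 (List.all_eq_true.1 h L hL)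
  simp only [List.all_eq_true, Bool.not_eq_true', lassoNear_eq_false_iff] at huL
  refine ⟨u, by simpa using hu, fun h => (huL u (by simpa using h)).1 rfl,
    isIndepSet_insert_iff.2 ⟨hS, fun v hv => (huL v (by simpa using hv)).2⟩⟩

end Enumeration

/-! ### Certificates for the weak Lefschetz property. -/

section Certificates

/-- A recipe for splitting a set of vertices successively along vertices `v` into the complement of
`v` and the complement of the closed neighborhood of `v`. -/
inductive SplitTree
  | leaf
  | node (v : ℕ) (l r : SplitTree)

namespace SplitTree

/-- Split along the vertices in a list, in every branch. -/
def ofList : List ℕ → SplitTree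
  | [] => leaf
  | v :: L => node v (ofList L) (ofList L)

/-- Apply a test at the leaves of a splitting. -/
noncomputable def check (m : ℕ) (test : List ℕ → ℕ → Bool) : SplitTree → List ℕ → ℕ → Bool
  | leaf, W, j => test W j
  | node _ _ _, W, 0 => test W 0
  | node v l r, W, j + 1 =>
    if W.elem v then
      check m test l (W.filter fun u => !Nat.beq u v) (j + 1) &&
        check m test r (W.filter fun u => !lassoNear m v u) j
    else check m test l W (j + 1)

/-- Abstract in `P` because injectivity and surjectivity obey the same splitting rule. -/
theorem of_check {m : ℕ} {test : List ℕ → ℕ → Bool} {P : Finset ℕ → ℕ → Prop}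
    (htest : ∀ W j, W.Nodup → test W j = true → P W.toFinset j)
    (hsplit : ∀ (W W' : Finset ℕ) (v j : ℕ), v ∈ W →
      (∀ u, u ∈ W' ↔ u ∈ W ∧ u ≠ v ∧ ¬ (lasso m).Adj v u) →
      P (W.erase v) (j + 1) → P W' j → P W (j + 1))
    (t : SplitTree) (W : List ℕ) (j : ℕ) (hW : W.Nodup) (h : t.check m test W j = true) :
    P W.toFinset j := by
  induction t generalizing W j with
  | leaf => exact htest W j hW (by simpa [check] using h)
  | node v l r ihl ihr =>
    cases j with
    | zero => exact htest W 0 hW (by simpa [check] using h)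
    | succ j =>
      rw [check] at h
      split_ifs at h with hv
      · rw [Bool.and_eq_true] at h
        refine hsplit W.toFinset (W.filter fun u => !lassoNear m v u).toFinset v j
          (by simpa using hv) (fun u => ?_) ?_ (ihr _ _ (hW.filter _) h.2)
        · simp only [List.mem_toFinset, List.mem_filter, Bool.not_eq_true',
            lassoNear_eq_false_iff, ne_comm]
        · convert ihl _ _ (hW.filter _) h.1 using 1
          ext u
          simp only [Finset.mem_erase, List.mem_toFinset, List.mem_filter, Bool.not_eq_true',
            ← Bool.not_eq_true, Nat.beq_eq]
          tauto
      · exact ihl W _ hW h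

end SplitTree

/-- The vertices of a tadpole graph in decreasing order. -/
def descending (N : ℕ) : List ℕ := (List.range N).reverse

theorem toFinset_descending (N : ℕ) : (descending N).toFinset = Finset.range N := by
  ext
  simp [descending]

theorem nodup_descending (N : ℕ) : (descending N).Nodup :=
  List.nodup_reverse.2 List.nodup_range

/-- A certificate for the weak Lefschetz property: injectivity up to degree `j`, surjectivity from
degree `j + 1` on. -/
theorem hasWLP_tadpole_of_check {m n : ℕ} (hm : 3 ≤ m) {𝕜 : Type*} [Field 𝕜] [CharZero 𝕜] (j : ℕ)
    (up down : SplitTree) (hup : up.check m (checkUp m) (descending (m + n)) j = true)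
    (hdown : down.check m (checkDown m) (descending (m + n)) (j + 1) = true)
    (hext : (List.range j).all (checkExtendable m (descending (m + n))) = true) :
    HasWLP ((tadpole m n).artinianGrading 𝕜) := by
  refine hasWLP_tadpole_of_zmod hm n 7 fun i => ?_
  -- Decreasing vertices make `indepLists` produce decreasing binary codes, the order in which
  -- `allPivots` meets the pivots.
  rw [← toFinset_descending]
  rcases le_or_gt i j with hij | hij
  · left
    refine Nat.decreasingInduction' (P := (lasso m).UpInjective (ZMod 7) _) (fun k hk _ ih => ?_)
      hij ?_
    · exact ih.of_succ (exists_insert_of_checkExtendable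
        (List.all_eq_true.1 hext k (List.mem_range.2 hk)))
    · exact up.of_check (fun W j _ h => upInjective_of_checkUp h)
        (fun W W' v j hv hW' h1 h2 => h1.split hv hW' h2) _ _ (nodup_descending _) hup
  · right
    exact (down.of_check (P := (lasso m).DownInjective (ZMod 7))
      (fun W j hW h => downInjective_of_checkDown hW h)
      (fun W W' v j hv hW' h1 h2 => h1.split hv hW' h2) _ _ (nodup_descending _) hdown).mono hij

end Certificates

/-! ### The tadpoles with the weak Lefschetz property. -/

section Positive

variable (𝕜 : Type*) [Field 𝕜] [CharZero 𝕜]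

set_option maxRecDepth 100000

theorem hasWLP_tadpole_4_2 : HasWLP ((tadpole 4 2).artinianGrading 𝕜) :=
  hasWLP_tadpole_of_check (by norm_num) 1
    .leaf .leaf (by decide +kernel) (by decide +kernel) (by decide +kernel)

theorem hasWLP_tadpole_5_2 : HasWLP ((tadpole 5 2).artinianGrading 𝕜) :=
  hasWLP_tadpole_of_check (by norm_num) 1
    .leaf .leaf (by decide +kernel) (by decide +kernel) (by decide +kernel)

theorem hasWLP_tadpole_7_2 : HasWLP ((tadpole 7 2).artinianGrading 𝕜) :=
  hasWLP_tadpole_of_check (by norm_num) 2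
    .leaf .leaf (by decide +kernel) (by decide +kernel) (by decide +kernel)

theorem hasWLP_tadpole_8_2 : HasWLP ((tadpole 8 2).artinianGrading 𝕜) :=
  hasWLP_tadpole_of_check (by norm_num) 2
    .leaf .leaf (by decide +kernel) (by decide +kernel) (by decide +kernel)

/-- From this size on, splitting replaces one large linear system by many small ones. Any choice of
vertices is legitimate as long as the tests at all leaves succeed. -/
theorem hasWLP_tadpole_11_2 : HasWLP ((tadpole 11 2).artinianGrading 𝕜) :=
  hasWLP_tadpole_of_check (by norm_num) 3
    (.ofList [11])
    (.ofList [4, 10, 11, 1, 7])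
    (by decide +kernel) (by decide +kernel) (by decide +kernel)

theorem hasWLP_tadpole_3_3 : HasWLP ((tadpole 3 3).artinianGrading 𝕜) :=
  hasWLP_tadpole_of_check (by norm_num) 1
    .leaf .leaf (by decide +kernel) (by decide +kernel) (by decide +kernel)

theorem hasWLP_tadpole_4_3 : HasWLP ((tadpole 4 3).artinianGrading 𝕜) :=
  hasWLP_tadpole_of_check (by norm_num) 1
    .leaf .leaf (by decide +kernel) (by decide +kernel) (by decide +kernel)

theorem hasWLP_tadpole_5_3 : HasWLP ((tadpole 5 3).artinianGrading 𝕜) :=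
  hasWLP_tadpole_of_check (by norm_num) 1
    .leaf .leaf (by decide +kernel) (by decide +kernel) (by decide +kernel)

theorem hasWLP_tadpole_6_3 : HasWLP ((tadpole 6 3).artinianGrading 𝕜) :=
  hasWLP_tadpole_of_check (by norm_num) 2
    .leaf .leaf (by decide +kernel) (by decide +kernel) (by decide +kernel)

theorem hasWLP_tadpole_7_3 : HasWLP ((tadpole 7 3).artinianGrading 𝕜) :=
  hasWLP_tadpole_of_check (by norm_num) 2
    .leaf .leaf (by decide +kernel) (by decide +kernel) (by decide +kernel)

theorem hasWLP_tadpole_8_3 : HasWLP ((tadpole 8 3).artinianGrading 𝕜) :=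
  hasWLP_tadpole_of_check (by norm_num) 2
    (.ofList [4, 9, 0, 7, 5])
    (.ofList [9])
    (by decide +kernel) (by decide +kernel) (by decide +kernel)

theorem hasWLP_tadpole_10_3 : HasWLP ((tadpole 10 3).artinianGrading 𝕜) :=
  hasWLP_tadpole_of_check (by norm_num) 3
    (.node 9 (.ofList [5, 7, 11, 3, 1]) .leaf)
    (.ofList [2, 11, 1, 8, 5])
    (by decide +kernel) (by decide +kernel) (by decide +kernel)

theorem hasWLP_tadpole_11_3 : HasWLP ((tadpole 11 3).artinianGrading 𝕜) :=
  hasWLP_tadpole_of_check (by norm_num) 3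
    (.ofList [3, 1, 10, 12, 7, 9, 5])
    (.node 12 (.ofList [1, 7, 10, 4]) .leaf)
    (by decide +kernel) (by decide +kernel) (by decide +kernel)

theorem hasWLP_tadpole_14_3 : HasWLP ((tadpole 14 3).artinianGrading 𝕜) :=
  hasWLP_tadpole_of_check (by norm_num) 4
    (.node 13 (.ofList [1, 7, 11, 5, 15, 9, 3]) (.ofList [6, 8, 16, 10, 4, 2]))
    (.node 15 (.ofList [8, 2, 11, 13, 5]) .leaf)
    (by decide +kernel) (by decide +kernel) (by decide +kernel)

theorem hasWLP_tadpole_4_1 : HasWLP ((tadpole 4 1).artinianGrading 𝕜) :=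
  hasWLP_tadpole_of_check (by norm_num) 1
    .leaf .leaf (by decide +kernel) (by decide +kernel) (by decide +kernel)

theorem hasWLP_tadpole_4_4 : HasWLP ((tadpole 4 4).artinianGrading 𝕜) :=
  hasWLP_tadpole_of_check (by norm_num) 1
    .leaf .leaf (by decide +kernel) (by decide +kernel) (by decide +kernel)

theorem hasWLP_tadpole_4_5 : HasWLP ((tadpole 4 5).artinianGrading 𝕜) :=
  hasWLP_tadpole_of_check (by norm_num) 2
    .leaf .leaf (by decide +kernel) (by decide +kernel) (by decide +kernel)

theorem hasWLP_tadpole_4_6 : HasWLP ((tadpole 4 6).artinianGrading 𝕜) :=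
  hasWLP_tadpole_of_check (by norm_num) 2
    .leaf .leaf (by decide +kernel) (by decide +kernel) (by decide +kernel)

theorem hasWLP_tadpole_4_7 : HasWLP ((tadpole 4 7).artinianGrading 𝕜) :=
  hasWLP_tadpole_of_check (by norm_num) 2
    (.ofList [5, 8, 10, 7])
    (.ofList [6, 9, 3])
    (by decide +kernel) (by decide +kernel) (by decide +kernel)

theorem hasWLP_tadpole_4_9 : HasWLP ((tadpole 4 9).artinianGrading 𝕜) :=
  hasWLP_tadpole_of_check (by norm_num) 3
    (.ofList [9, 3, 5, 7, 11])
    (.ofList [10, 7, 4, 11, 3])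
    (by decide +kernel) (by decide +kernel) (by decide +kernel)

theorem hasWLP_tadpole_4_10 : HasWLP ((tadpole 4 10).artinianGrading 𝕜) :=
  hasWLP_tadpole_of_check (by norm_num) 3
    (.ofList [12, 6, 4, 2, 10, 0, 8])
    (.node 3 (.ofList [12, 5, 6, 1, 9]) (.ofList [6, 12, 9]))
    (by decide +kernel) (by decide +kernel) (by decide +kernel)

theorem hasWLP_tadpole_4_13 : HasWLP ((tadpole 4 13).artinianGrading 𝕜) :=
  hasWLP_tadpole_of_check (by norm_num) 4
    (.node 3 (.ofList [7, 13, 11, 9, 1, 15, 5]) (.ofList [5, 7, 15, 9, 13, 11]))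
    (.node 3 (.ofList [14, 11, 1, 15, 5, 8]) (.ofList [12, 15, 6, 9]))
    (by decide +kernel) (by decide +kernel) (by decide +kernel)

theorem hasWLP_tadpole_5_1 : HasWLP ((tadpole 5 1).artinianGrading 𝕜) :=
  hasWLP_tadpole_of_check (by norm_num) 1
    .leaf .leaf (by decide +kernel) (by decide +kernel) (by decide +kernel)

theorem hasWLP_tadpole_5_5 : HasWLP ((tadpole 5 5).artinianGrading 𝕜) :=
  hasWLP_tadpole_of_check (by norm_num) 2
    .leaf .leaf (by decide +kernel) (by decide +kernel) (by decide +kernel)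

theorem hasWLP_tadpole_5_6 : HasWLP ((tadpole 5 6).artinianGrading 𝕜) :=
  hasWLP_tadpole_of_check (by norm_num) 2
    (.ofList [7, 5, 4, 3, 9])
    (.ofList [6, 9])
    (by decide +kernel) (by decide +kernel) (by decide +kernel)

theorem hasWLP_tadpole_5_9 : HasWLP ((tadpole 5 9).artinianGrading 𝕜) :=
  hasWLP_tadpole_of_check (by norm_num) 3
    (.ofList [8, 6, 12, 0, 2, 4, 10])
    (.node 6 (.ofList [1, 12, 8, 2, 11]) (.ofList [9, 12]))
    (by decide +kernel) (by decide +kernel) (by decide +kernel)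

end Positive

end SimpleGraph

/-! ### The classification. -/

theorem theorem1p2 (𝕜 : Type*) [Field 𝕜] [CharZero 𝕜] :
    (∀ m : ℕ, 3 ≤ m →
      (HasWLP ((SimpleGraph.tadpole m 2).artinianGrading 𝕜) ↔
        m ∈ ({4, 5, 7, 8, 11} : Set ℕ))) ∧
    (∀ m : ℕ, 3 ≤ m →
      (HasWLP ((SimpleGraph.tadpole m 3).artinianGrading 𝕜) ↔
        m ∈ ({3, 4, 5, 6, 7, 8, 10, 11, 14} : Set ℕ))) ∧
    (∀ n : ℕ, 1 ≤ n →
      (HasWLP ((SimpleGraph.tadpole 4 n).artinianGrading 𝕜) ↔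
        n ∈ ({1, 2, 3, 4, 5, 6, 7, 9, 10, 13} : Set ℕ))) ∧
    (∀ n : ℕ, 1 ≤ n →
      (HasWLP ((SimpleGraph.tadpole 5 n).artinianGrading 𝕜) ↔
        n ∈ ({1, 2, 3, 5, 6, 9} : Set ℕ))) := by
  simp only [Set.mem_insert_iff, Set.mem_singleton_iff]
  refine ⟨fun m hm => ⟨fun h => ?_, ?_⟩, fun m hm => ⟨fun h => ?_, ?_⟩,
    fun n hn => ⟨fun h => ?_, ?_⟩, fun n hn => ⟨fun h => ?_, ?_⟩⟩
  · by_contra hne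
    by_cases hle : (m + 2 + 3) / 4 + 1 ≤ (m + 2) / 3
    · exact SimpleGraph.not_hasWLP_tadpole_of_le hm hle h
    -- The counting argument leaves exactly m = 3, 6, 9, 12, 15.
    · obtain rfl | hm := hm.eq_or_lt
      · exact SimpleGraph.not_hasWLP_tadpole_three_two h
      · exact SimpleGraph.not_hasWLP_tadpole_two hm (by omega) (by omega) h
  · rintro (rfl | rfl | rfl | rfl | rfl)
    exacts [SimpleGraph.hasWLP_tadpole_4_2 𝕜, SimpleGraph.hasWLP_tadpole_5_2 𝕜,
      SimpleGraph.hasWLP_tadpole_7_2 𝕜, SimpleGraph.hasWLP_tadpole_8_2 𝕜,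
      SimpleGraph.hasWLP_tadpole_11_2 𝕜]
  · by_contra hne
    -- The numbers of vertices escaping the inequality, at most 11 or one of 13, 14, 17, are here
    -- exactly the listed cases.
    exact SimpleGraph.not_hasWLP_tadpole_of_le hm (by omega) h
  · rintro (rfl | rfl | rfl | rfl | rfl | rfl | rfl | rfl | rfl)
    exacts [SimpleGraph.hasWLP_tadpole_3_3 𝕜, SimpleGraph.hasWLP_tadpole_4_3 𝕜,
      SimpleGraph.hasWLP_tadpole_5_3 𝕜, SimpleGraph.hasWLP_tadpole_6_3 𝕜,
      SimpleGraph.hasWLP_tadpole_7_3 𝕜, SimpleGraph.hasWLP_tadpole_8_3 𝕜,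
      SimpleGraph.hasWLP_tadpole_10_3 𝕜, SimpleGraph.hasWLP_tadpole_11_3 𝕜,
      SimpleGraph.hasWLP_tadpole_14_3 𝕜]
  · by_contra hne
    exact SimpleGraph.not_hasWLP_tadpole_of_le (by norm_num) (by omega) h
  · rintro (rfl | rfl | rfl | rfl | rfl | rfl | rfl | rfl | rfl | rfl)
    exacts [SimpleGraph.hasWLP_tadpole_4_1 𝕜, SimpleGraph.hasWLP_tadpole_4_2 𝕜,
      SimpleGraph.hasWLP_tadpole_4_3 𝕜, SimpleGraph.hasWLP_tadpole_4_4 𝕜,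
      SimpleGraph.hasWLP_tadpole_4_5 𝕜, SimpleGraph.hasWLP_tadpole_4_6 𝕜,
      SimpleGraph.hasWLP_tadpole_4_7 𝕜, SimpleGraph.hasWLP_tadpole_4_9 𝕜,
      SimpleGraph.hasWLP_tadpole_4_10 𝕜, SimpleGraph.hasWLP_tadpole_4_13 𝕜]
  · by_contra hne
    by_cases hle : (5 + n + 3) / 4 + 1 ≤ (5 + n) / 3
    · exact SimpleGraph.not_hasWLP_tadpole_of_le (by norm_num) hle h
    -- The counting argument leaves 9, 13 and 17 vertices.
    · exact SimpleGraph.not_hasWLP_tadpole_five (by omega) h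
  · rintro (rfl | rfl | rfl | rfl | rfl | rfl)
    exacts [SimpleGraph.hasWLP_tadpole_5_1 𝕜, SimpleGraph.hasWLP_tadpole_5_2 𝕜,
      SimpleGraph.hasWLP_tadpole_5_3 𝕜, SimpleGraph.hasWLP_tadpole_5_5 𝕜,
      SimpleGraph.hasWLP_tadpole_5_6 𝕜, SimpleGraph.hasWLP_tadpole_5_9 𝕜]
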